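/- Let $n\ge 1$, let $\Delta$ be the Laplacian of the standard metric on the sphere $S^n$, and let $\{\varphi_i\}_{i\ge0}$ be an orthonormal basis of $L^2(S^n)$ of smooth real eigenfunctions, $-\Delta\varphi_i=\lambda_i^2\varphi_i$ with frequencies $\lambda_i\ge 0$. For $s\ge0$ set $\|f\|_{H^s}^2=\sum_i(1+\lambda_i^2)^s|\langle f,\varphi_i\rangle|^2$. For $f\in L^2(S^n)$ let $f_0$ be its projection to the frequencies $\lambda_i\le 1$ and, for $l\ge1$, let $f_l$ be its projection to the frequencies $\lambda_i\in(2^{l-1},2^l]$. Let $q'\ge1$ be a constant and let $f_1,f_2,f_3$ be real functions of $\tau$ with $|f_1|+|f_2|+|f_3|\le K$ on $(0,1]$. Consider the model system $$\partial_\tau^2\alpha+\frac1\tau\partial_\tau\alpha+4q'\alpha-\frac{4}{(\tau^2+1)^2}\Delta\alpha=f_1(\tau)\,\tau\,\partial_\tau\alpha+f_2(\tau)\,\tau^2\alpha+f_3(\tau)\,\chi,\qquad \partial_\tau\chi=2\tau\alpha .$$ Given $\chi(0),\mathcal O,h\in C^\infty(S^n)$, a smooth solution with asymptotic initial data $(\chi(0),\mathcal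 O,h)$ is a pair of real functions $\alpha,\chi\in C^\infty((0,\infty)\times S^n)$ that solves the system for $\tau>0$, such that $\alpha-\mathcal O\log\tau-h$ and $\chi$ extend to elements of $C^1_\tau([0,\infty))C^\infty(S^n)$, $\chi$ takes the value $\chi(0)$ at $\tau=0$, and, as $\tau\to0^+$, $$\alpha(\tau)=\mathcal O\log\tau+h+O(\tau^2|\log\tau|^2),\qquad \partial_\tau\alpha(\tau)=\frac{\mathcal O}{\tau}+O(\tau|\log\tau|^2)\qquad\text{in }C^\infty(S^n).$$ **Theorem.** Let $s\ge1$. There is a constant $C$, depending only on $n,s,q'$ and $K$, such that every smooth solution $(\alpha,\chi)$ with asymptotic initial data $(\chi(0),\mathcal O,h)$ satisfies, with $\mathfrak h:=h-(\log\nabla)\mathcal O:=h-\sum_{l\ge1}l\log 2\cdot\mathcal O_l$, $$\Big(\|\alpha\|_{H^{s+1/2}}+\|\partial_\tau\alpha\|_{H^{s-1/2}}\Big)\Big|_{\tau=1}\le C\Big(\|\mathfrak h\|_{H^s}+\|\mathcal O\|_{H^s}+\|\chi(0)\|_{H^{s-1/2}}\Big),$$ $$\|\chi(1)\|_{H^{s+1/2}}\le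 C\Big(\|\mathfrak h\|_{H^s}+\|\mathcal O\|_{H^s}+\|\chi(0)\|_{H^{s+1/2}}\Big).$$ -/

import Mathlib

open Set Filter Topology MeasureTheory
open scoped Manifold ContDiff ENNReal NNReal

noncomputable section

namespace ModelSystem

/-- The unit sphere `S^n` in `ℝ^(n+1)`. -/
abbrev Sph (n : ℕ) : Type := Metric.sphere (0 : EuclideanSpace ℝ (Fin (n + 1))) 1

/-- The class `C^∞(S^n)` of smooth real-valued functions. -/
def IsSmooth {n : ℕ} (f : Sph n → ℝ) : Prop :=
  ContMDiff (𝓡 n) 𝓘(ℝ, ℝ) ∞ f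

/-- The extension of `f : S^n → ℝ` to `ℝ^(n+1)` that is constant along rays,
`y ↦ f (y / |y|)` for `y ≠ 0` (the value at the origin is irrelevant). -/
def ext {n : ℕ} (f : Sph n → ℝ) (y : EuclideanSpace ℝ (Fin (n + 1))) : ℝ :=
  if hy : y = 0 then 0
  else f ⟨‖y‖⁻¹ • y, by
    rw [mem_sphere_zero_iff_norm, norm_smul, norm_inv, norm_norm,
      inv_mul_cancel₀ (norm_ne_zero_iff.mpr hy)]⟩

/-- The Laplacian of the standard (round) metric on `S^n`: the restriction to the sphere of the
Euclidean Laplacian of the extension that is constant along rays. -/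
def sphLap {n : ℕ} (f : Sph n → ℝ) (x : Sph n) : ℝ :=
  Laplacian.laplacian (ext f) (x : EuclideanSpace ℝ (Fin (n + 1)))

/-! ### The space `L²(S^n)`, spectral projections and Sobolev norms -/

/-- The standard surface measure on `S^n`. -/
def sphVol (n : ℕ) : Measure (Sph n) :=
  (volume : Measure (EuclideanSpace ℝ (Fin (n + 1)))).toSphere

/-- The space `L²(S^n)` of real-valued functions. -/
abbrev L2 (n : ℕ) : Type := Lp ℝ 2 (sphVol n)

open Classical in
/-- The class in `L²(S^n)` of a square-integrable function (`0` for any other function). -/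
def toL2 {n : ℕ} (f : Sph n → ℝ) : L2 n :=
  if hf : MemLp f 2 (sphVol n) then hf.toLp f else 0

/-- The closed span in `L²(S^n)` of the smooth eigenfunctions of the Laplacian with frequency in
`I`. An eigenfunction `φ` has frequency `r ≥ 0` when `-Δ φ = r² φ`. -/
def spectralSpace (n : ℕ) (I : Set ℝ≥0) : Submodule ℝ (L2 n) :=
  (Submodule.span ℝ {u : L2 n | ∃ φ : Sph n → ℝ, IsSmooth φ ∧
    (∃ r ∈ I, ∀ x, -sphLap φ x = (r : ℝ) ^ 2 * φ x) ∧ u = toL2 φ}).topologicalClosure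

instance spectralSpace_hasOrthogonalProjection (n : ℕ) (I : Set ℝ≥0) :
    (spectralSpace n I).HasOrthogonalProjection :=
  haveI : CompleteSpace (spectralSpace n I) :=
    (Submodule.isClosed_topologicalClosure _).completeSpace_coe
  inferInstance

/-- The frequency projection `P_I`: the `L²`-orthogonal projection to the frequencies in `I`. -/
def freqProj {n : ℕ} (I : Set ℝ≥0) (f : L2 n) : L2 n :=
  (spectralSpace n I).starProjection f

/-- The Sobolev norm `‖f‖_{H^s} = (∑_r (1 + r²)^s ‖P_r f‖²)^(1/2)`, where `r` runs through the
frequencies and `P_r` is the orthogonal projection to the eigenspace of frequency `r`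
(which is `0` unless `r²` is an eigenvalue of `-Δ`). The value is `∞` when `f` is not in `H^s`.
Expanding `‖P_r f‖²` in an orthonormal basis of each eigenspace gives
`∑_i (1 + r_i²)^s ⟨f, φ_i⟩²`. -/
def sobNorm {n : ℕ} (s : ℝ) (f : L2 n) : ℝ≥0∞ :=
  (∑' r : ℝ≥0, ENNReal.ofReal ((1 + (r : ℝ) ^ 2) ^ s) * ‖freqProj {r} f‖ₑ ^ 2) ^ (1 / 2 : ℝ)

/-- The Littlewood-Paley pieces: `f_0 = P_{≤ 1} f` and `f_l = P_{(2^(l-1), 2^l]} f` for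
`l ≥ 1`. -/
def lpPiece {n : ℕ} (f : L2 n) : ℕ → L2 n
  | 0 => freqProj (Iic 1) f
  | l + 1 => freqProj (Ioc (2 ^ l) (2 ^ (l + 1))) f

/-- The Fourier multiplier `(log ∇) f = ∑_{l ≥ 1} l log 2 · f_l`. -/
def logNabla {n : ℕ} (f : L2 n) : L2 n :=
  ∑' l : ℕ, ((l : ℝ) * Real.log 2) • lpPiece f l

/-! ### The Fréchet space `C^∞(S^n)` -/

/-- All derivatives of order `k` of `f` (of its extension that is constant along rays) are bounded
by `c` on the sphere. The best constants are seminorms that define, for `k = 0, 1, 2, …`, the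
topology of `C^∞(S^n)`. -/
def DerivBound {n : ℕ} (k : ℕ) (f : Sph n → ℝ) (c : ℝ) : Prop :=
  ∀ x : Sph n, ‖iteratedFDeriv ℝ k (ext f) (x : EuclideanSpace ℝ (Fin (n + 1)))‖ ≤ c

/-- `u(τ) → v` in `C^∞(S^n)` along the filter `F`. -/
def SmoothTendsto {n : ℕ} (F : Filter ℝ) (u : ℝ → Sph n → ℝ) (v : Sph n → ℝ) : Prop :=
  ∀ k : ℕ, ∀ ε : ℝ, 0 < ε → ∀ᶠ τ in F, DerivBound k (fun x => u τ x - v x) ε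

/-- `u(τ) = O(g(τ))` in `C^∞(S^n)` as `τ → 0`, `τ > 0`. -/
def SmoothBigO {n : ℕ} (u : ℝ → Sph n → ℝ) (g : ℝ → ℝ) : Prop :=
  ∀ k : ℕ, ∃ c : ℝ, ∀ᶠ τ in 𝓝[>] (0 : ℝ), DerivBound k (u τ) (c * g τ)

/-- `u ∈ C^1_τ([0,∞)) C^∞(S^n)`: `u` is a continuously differentiable map from `[0,∞)` (with
one-sided derivative at `0`) to the Fréchet space `C^∞(S^n)`. -/
def IsC1Smooth {n : ℕ} (u : ℝ → Sph n → ℝ) : Prop :=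
  (∀ τ, 0 ≤ τ → IsSmooth (u τ)) ∧
  ∃ u' : ℝ → Sph n → ℝ,
    (∀ τ, 0 ≤ τ → IsSmooth (u' τ)) ∧
    (∀ τ, 0 ≤ τ → SmoothTendsto (𝓝[Ici 0] τ) u' (u' τ)) ∧
    (∀ τ, 0 ≤ τ → SmoothTendsto (𝓝[Ici 0 \ {τ}] τ)
      (fun t x => (t - τ)⁻¹ * (u t x - u τ x)) (u' τ))

/-! ### The model system -/

/-- The time derivative `∂_τ u`. -/
def dτ {n : ℕ} (u : ℝ → Sph n → ℝ) (τ : ℝ) (x : Sph n) : ℝ :=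
  deriv (fun t => u t x) τ

/-- `u ∈ C^∞((0,∞) × S^n)`. -/
def IsSmoothSpacetime {n : ℕ} (u : ℝ → Sph n → ℝ) : Prop :=
  ContMDiffOn (𝓘(ℝ, ℝ).prod (𝓡 n)) 𝓘(ℝ, ℝ) ∞
    (fun p : ℝ × Sph n => u p.1 p.2) (Ioi (0 : ℝ) ×ˢ univ)

/-- `(α, χ)` is a smooth solution, on `(0,∞) × S^n`, of the model system
`∂_τ² α + τ⁻¹ ∂_τ α + 4 q α - 4 (τ² + 1)⁻² Δ α = f₁ τ ∂_τ α + f₂ τ² α + f₃ χ`,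
`∂_τ χ = 2 τ α`, with asymptotic initial data `(χ₀, O, h)` at `τ = 0`. -/
structure IsSmoothSolution {n : ℕ} (q : ℝ) (f₁ f₂ f₃ : ℝ → ℝ) (χ₀ O h : Sph n → ℝ)
    (α χ : ℝ → Sph n → ℝ) : Prop where
  smooth_data : IsSmooth χ₀ ∧ IsSmooth O ∧ IsSmooth h
  smooth_α : IsSmoothSpacetime α
  smooth_χ : IsSmoothSpacetime χ
  eq_α : ∀ τ, 0 < τ → ∀ x,
    dτ (dτ α) τ x + 1 / τ * dτ α τ x + 4 * q * α τ x - 4 / (τ ^ 2 + 1) ^ 2 * sphLap (α τ) x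
      = f₁ τ * τ * dτ α τ x + f₂ τ * τ ^ 2 * α τ x + f₃ τ * χ τ x
  eq_χ : ∀ τ, 0 < τ → ∀ x, dτ χ τ x = 2 * τ * α τ x
  /-- `α - O log τ - h` extends to `τ = 0` as an element of `C^1_τ([0,∞)) C^∞(S^n)`. -/
  reg_α : ∃ u : ℝ → Sph n → ℝ, IsC1Smooth u ∧
    ∀ τ, 0 < τ → ∀ x, u τ x = α τ x - O x * Real.log τ - h x
  reg_χ : IsC1Smooth χ
  init_χ : χ 0 = χ₀
  expansion_α : SmoothBigO (fun τ x => α τ x - O x * Real.log τ - h x)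
    (fun τ => τ ^ 2 * |Real.log τ| ^ 2)
  expansion_dα : SmoothBigO (fun τ x => dτ α τ x - O x / τ)
    (fun τ => τ * |Real.log τ| ^ 2)

end ModelSystem

end

/-! The Laplacian is symmetric and the other coefficients depend on `τ` only, so pairing the system
with an eigenfunction of frequency `lam` gives an ODE for `a = ⟨α, φ⟩`, `b = a'`, `c = ⟨χ, φ⟩`: a
damped oscillator with squared frequency `w` comparable to `Λ² = 1 + lam²` on `(0, 1]`. Everything
reduces to a bound for this ODE with a constant independent of `Λ`.

For `Λ τ ≤ 1` the solution behaves like `p log (Λ τ) + r` with `p = τ b`. The quantity `N = p² + r²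
+ κ c²` satisfies `N' ≤ B Λ N`, because `Λ τ (1 + |log (Λ τ)|)² ≤ 4`; over an interval of length
`Λ⁻¹` this costs only `exp B` (`low_estimate`). The limits of `p` and `r` at `0` are `⟨O, φ⟩` and
`⟨h, φ⟩ - ⟨O, φ⟩ log Λ`. As `log Λ` and `l log 2` differ by at most `1` on the `l`-th dyadic block
(`abs_log_sub_le`), the second limit is `⟨𝔥, φ⟩` up to a bounded multiple of `⟨O, φ⟩`. This is why
`𝔥` appears.

For `1 ≤ Λ τ` the solution oscillates. In the derivative of `τ (b² + w a²) + a b + Λ κ c²` the term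
`a b` cancels `w a² - b²`, which the energy alone would leave, and the remaining rate `1 / (Λ τ²) +
A` has bounded integral over `[1/Λ, 1]` (`high_estimate`). This energy is at most a multiple of `Λ
N` at `1/Λ` and controls `Λ² a² + b²` at `1`, which is the gain of half a derivative. The weight `κ`
is `Λ⁻¹` for the bound on `α` and `Λ` for the bound on `χ`.

Symmetry of the Laplacian comes from Green's identity in Euclidean space with a radial cutoff,
applied to extensions constant along rays (`integral_mul_sphLap_comm`). The norm of a projection to
an eigenspace is recovered by testing against eigenfunctions, so neither finite multiplicity nor
completeness of the eigenfunctions is needed. -/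

namespace ModelSystem

/-! ### Monotonicity and an inequality for the logarithm -/

/-- A function with derivative `≤ 0` on `(0, T]` is bounded by its limit at `0`. -/
theorem le_lim_of_deriv_nonpos {f f' : ℝ → ℝ} {T l : ℝ} (hT : 0 < T)
    (hf : ∀ τ, 0 < τ → HasDerivAt f (f' τ) τ) (hf' : ∀ τ ∈ Ioc 0 T, f' τ ≤ 0)
    (hl : Tendsto f (𝓝[>] 0) (𝓝 l)) : f T ≤ l := by
  have hanti : AntitoneOn f (Ioc 0 T) := by
    refine antitoneOn_of_deriv_nonpos (convex_Ioc _ _)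
      (fun τ hτ => (hf τ hτ.1).continuousAt.continuousWithinAt)
      (fun τ hτ => ?_) (fun τ hτ => ?_)
    · rw [interior_Ioc] at hτ
      exact (hf τ hτ.1).differentiableAt.differentiableWithinAt
    · rw [interior_Ioc] at hτ
      rw [(hf τ hτ.1).deriv]
      exact hf' τ ⟨hτ.1, hτ.2.le⟩
  refine ge_of_tendsto hl ?_
  filter_upwards [Ioc_mem_nhdsGT hT] with τ hτ
  exact hanti hτ ⟨hT, le_rfl⟩ hτ.2

theorem le_of_deriv_nonpos {f f' : ℝ → ℝ} {S T : ℝ} (hS : 0 < S) (hST : S ≤ T)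
    (hf : ∀ τ, 0 < τ → HasDerivAt f (f' τ) τ) (hf' : ∀ τ ∈ Icc S T, f' τ ≤ 0) : f T ≤ f S := by
  have hanti : AntitoneOn f (Icc S T) := by
    refine antitoneOn_of_deriv_nonpos (convex_Icc _ _)
      (fun τ hτ => (hf τ (hS.trans_le hτ.1)).continuousAt.continuousWithinAt)
      (fun τ hτ => ?_) (fun τ hτ => ?_)
    · rw [interior_Icc] at hτ
      exact (hf τ (hS.trans hτ.1)).differentiableAt.differentiableWithinAt
    · rw [interior_Icc] at hτ
      rw [(hf τ (hS.trans hτ.1)).deriv]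
      exact hf' τ ⟨hτ.1.le, hτ.2.le⟩
  exact hanti ⟨le_rfl, hST⟩ ⟨hST, le_rfl⟩ hST

/-- Follows from `log y ≤ y - 1` at `y = σ^(-1/2)`. With `σ = Λ τ` it absorbs both logarithms of the
low-frequency regime into one factor `Λ τ`. -/
theorem mul_one_add_abs_log_sq_le {σ : ℝ} (h0 : 0 < σ) (h1 : σ ≤ 1) :
    σ * (1 + |Real.log σ|) ^ 2 ≤ 4 := by
  have hs : 0 < √σ := Real.sqrt_pos.2 h0
  have hlog : |Real.log σ| = 2 * Real.log (√σ)⁻¹ := by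
    rw [abs_of_nonpos (Real.log_nonpos h0.le h1), Real.log_inv, Real.log_sqrt h0.le]; ring
  have h2 : Real.log (√σ)⁻¹ ≤ (√σ)⁻¹ - 1 := Real.log_le_sub_one_of_pos (inv_pos.2 hs)
  have h3 : √σ * (1 + |Real.log σ|) ≤ 2 := by
    calc √σ * (1 + |Real.log σ|) ≤ √σ * (1 + 2 * ((√σ)⁻¹ - 1)) := by
          rw [hlog]; gcongr
      _ = 2 - √σ := by field_simp; ring
      _ ≤ 2 := by linarith
  calc σ * (1 + |Real.log σ|) ^ 2 = (√σ * (1 + |Real.log σ|)) ^ 2 := by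
        rw [mul_pow, Real.sq_sqrt h0.le]
    _ ≤ 2 ^ 2 := by gcongr
    _ = 4 := by norm_num

/-! ### The ODE of a single mode -/

/-- The squared frequency `4 q + 4 λ² (τ² + 1)⁻²` of a mode. -/
noncomputable def modeWeight (q lam τ : ℝ) : ℝ := 4 * q + 4 * lam ^ 2 / (τ ^ 2 + 1) ^ 2

/-- A solution of the equations for a single mode of frequency `lam`; `b` and `b'` stand for the
first and second derivative of `a`. -/
structure IsModeSolution (q lam : ℝ) (f₁ f₂ f₃ a b b' c : ℝ → ℝ) : Prop where
  deriv_a : ∀ τ, 0 < τ → HasDerivAt a (b τ) τ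
  deriv_b : ∀ τ, 0 < τ → HasDerivAt b (b' τ) τ
  deriv_c : ∀ τ, 0 < τ → HasDerivAt c (2 * τ * a τ) τ
  eq : ∀ τ, 0 < τ → b' τ = -(b τ / τ) - modeWeight q lam τ * a τ
    + (f₁ τ * τ * b τ + f₂ τ * τ ^ 2 * a τ + f₃ τ * c τ)

theorem modeWeight_le {q lam τ : ℝ} (hq : 1 ≤ q) :
    modeWeight q lam τ ≤ 4 * q * (1 + lam ^ 2) := by
  unfold modeWeight
  have : 4 * lam ^ 2 / (τ ^ 2 + 1) ^ 2 ≤ 4 * lam ^ 2 :=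
    div_le_self (by positivity) (one_le_pow₀ (by nlinarith [sq_nonneg τ]))
  nlinarith [sq_nonneg lam]

/-- On `[0, 1]` the denominator is at most `4`, which the factor `4` in front of `lam ^ 2`
compensates. -/
theorem le_modeWeight {q lam τ : ℝ} (hq : 1 ≤ q) (h0 : 0 ≤ τ) (h1 : τ ≤ 1) :
    1 + lam ^ 2 ≤ modeWeight q lam τ := by
  unfold modeWeight
  have : lam ^ 2 ≤ 4 * lam ^ 2 / (τ ^ 2 + 1) ^ 2 := by
    rw [le_div_iff₀ (by positivity), mul_comm]
    have : (τ ^ 2 + 1) ^ 2 ≤ (1 ^ 2 + 1) ^ 2 := by gcongr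
    nlinarith [sq_nonneg lam]
  linarith

/-- The weight decreases for `τ ≥ 0`, so its derivative enters the energy estimate with a favourable
sign. -/
theorem hasDerivAt_modeWeight (q lam τ : ℝ) :
    HasDerivAt (modeWeight q lam) (-(16 * τ * lam ^ 2 / (τ ^ 2 + 1) ^ 3)) τ := by
  unfold modeWeight
  have h : HasDerivAt (fun τ : ℝ => (τ ^ 2 + 1) ^ 2) (2 * (τ ^ 2 + 1) * (2 * τ)) τ := by
    exact ((((hasDerivAt_id' τ).pow 2).add_const 1).pow 2).congr_deriv (by norm_num)
  refine (((hasDerivAt_const τ (4 * lam ^ 2)).div h (by positivity)).const_add (4 * q)).congr_deriv ?_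
  field_simp
  ring

theorem abs_mul_abs_le (x y : ℝ) : |x| * |y| ≤ (x ^ 2 + y ^ 2) / 2 := by
  rw [← sq_abs x, ← sq_abs y]
  linarith [two_mul_le_add_sq |x| |y|]

/-- The right-hand side of the growth estimate on `(0, 1/Λ]`, pointwise in `τ`. -/
theorem low_growth {q K Λ κ τ φ₁ φ₂ φ₃ w a p r c : ℝ} (hK : 0 ≤ K) (hq : 1 ≤ q) (hΛ : 1 ≤ Λ)
    (hκ : Λ⁻¹ ≤ κ) (hκ' : κ ≤ Λ) (hτ0 : 0 < τ) (hσ : Λ * τ ≤ 1) (h1 : |φ₁| ≤ K) (h2 : |φ₂| ≤ K)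
    (h3 : |φ₃| ≤ K) (hw0 : 0 ≤ w) (hw : w ≤ 4 * q * Λ ^ 2)
    (ha : a = r + p * Real.log (Λ * τ)) :
    2 * p * (τ * (-(w * a) + (φ₁ * p + φ₂ * τ ^ 2 * a + φ₃ * c)))
      - 2 * r * (τ * Real.log (Λ * τ) * (-(w * a) + (φ₁ * p + φ₂ * τ ^ 2 * a + φ₃ * c)))
      + 4 * κ * c * τ * a
      ≤ 16 * (4 * q + 3 * K + 1) * Λ * (p ^ 2 + r ^ 2 + κ * c ^ 2) := by
  have hΛ0 : 0 < Λ := by linarith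
  have hκ0 : 0 < κ := (inv_pos.2 hΛ0).trans_le hκ
  have hτ1' : τ ≤ 1 := (le_mul_of_one_le_left hτ0.le hΛ).trans hσ
  have hΛsq : 1 ≤ Λ ^ 2 := one_le_pow₀ hΛ
  have hΛle : Λ ≤ Λ ^ 2 := le_self_pow₀ hΛ two_ne_zero
  obtain ⟨M, hM⟩ : ∃ M, M = 4 * q + 3 * K := ⟨_, rfl⟩
  obtain ⟨L, hL⟩ : ∃ L, L = Real.log (Λ * τ) := ⟨_, rfl⟩
  obtain ⟨G, hG⟩ : ∃ G, G = -(w * a) + (φ₁ * p + φ₂ * τ ^ 2 * a + φ₃ * c) := ⟨_, rfl⟩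
  obtain ⟨N, hN⟩ : ∃ N, N = p ^ 2 + r ^ 2 + κ * c ^ 2 := ⟨_, rfl⟩
  obtain ⟨N', hN'⟩ : ∃ N', N' = 2 * p * (τ * G) - 2 * r * (τ * L * G) + 4 * κ * c * τ * a :=
    ⟨_, rfl⟩
  rw [← hM, ← hN, ← hL, ← hG, ← hN']
  rw [← hL] at ha
  have hNn : 0 ≤ N := by rw [hN]; positivity
  -- All unknowns are measured by `S = √N`: `p` and `r` directly, `a` with a logarithmic loss `ℓ`,
  -- and `c`, `κ c` with a loss `Λ` since `Λ⁻¹ ≤ κ ≤ Λ`.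
  obtain ⟨S, hSdef⟩ : ∃ S, S = √N := ⟨_, rfl⟩
  have hS0 : 0 ≤ S := hSdef ▸ Real.sqrt_nonneg _
  have hSS : S ^ 2 = N := hSdef ▸ Real.sq_sqrt hNn
  obtain ⟨ℓ, hℓ⟩ : ∃ ℓ, ℓ = 1 + |L| := ⟨_, rfl⟩
  have hℓ1 : 1 ≤ ℓ := by simp [hℓ]
  have hLℓ : |L| ≤ ℓ := by simp [hℓ]
  have hpS : |p| ≤ S := hSdef ▸ Real.abs_le_sqrt (by
    rw [hN]; linarith [sq_nonneg r, mul_nonneg hκ0.le (sq_nonneg c)])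
  have hrS : |r| ≤ S := hSdef ▸ Real.abs_le_sqrt (by
    rw [hN]; linarith [sq_nonneg p, mul_nonneg hκ0.le (sq_nonneg c)])
  have hκc : κ * c ^ 2 ≤ S ^ 2 := by
    rw [hSS, hN]; linarith [sq_nonneg p, sq_nonneg r]
  have hcS : |c| ≤ Λ * S := by
    refine abs_le_of_sq_le_sq ?_ (by positivity)
    have : 1 ≤ Λ * κ := by
      calc 1 = Λ * Λ⁻¹ := by field_simp
        _ ≤ Λ * κ := by gcongr
    calc c ^ 2 ≤ (Λ * κ) * c ^ 2 := le_mul_of_one_le_left (sq_nonneg _) this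
      _ = Λ * (κ * c ^ 2) := by ring
      _ ≤ Λ * S ^ 2 := by gcongr
      _ ≤ (Λ * S) ^ 2 := by rw [mul_pow]; gcongr
  have hκcS : κ * |c| ≤ Λ * S := by
    refine le_of_sq_le_sq ?_ (by positivity)
    calc (κ * |c|) ^ 2 = κ * (κ * c ^ 2) := by rw [mul_pow, sq_abs]; ring
      _ ≤ Λ * S ^ 2 := by gcongr
      _ ≤ (Λ * S) ^ 2 := by rw [mul_pow]; gcongr
  have haS : |a| ≤ ℓ * S := by
      calc |a| ≤ |r| + |p * L| := by rw [ha]; exact abs_add_le _ _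
      _ ≤ S + S * |L| := by rw [abs_mul]; gcongr
      _ = ℓ * S := by rw [hℓ]; ring
  have hGS : |G| ≤ M * Λ ^ 2 * ℓ * S := by
    calc |G| ≤ w * |a| + (|φ₁| * |p| + |φ₂| * τ ^ 2 * |a|
            + |φ₃| * |c|) := by
          rw [hG]
          refine (abs_add_le _ _).trans (add_le_add ?_ ((abs_add_three _ _ _).trans ?_))
          · rw [abs_neg, abs_mul, abs_of_nonneg hw0]
          · simp only [abs_mul, abs_of_nonneg (sq_nonneg τ)]; rfl
      _ ≤ (4 * q * Λ ^ 2) * (ℓ * S) + (K * (Λ ^ 2 * ℓ * S) + K * 1 * (Λ ^ 2 * ℓ * S)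
            + K * (Λ ^ 2 * ℓ * S)) := by
          have e1 : S ≤ Λ ^ 2 * ℓ * S :=
            le_mul_of_one_le_left hS0 (one_le_mul_of_one_le_of_one_le hΛsq hℓ1)
          have e2 : ℓ * S ≤ Λ ^ 2 * ℓ * S := by
            rw [mul_assoc]; exact le_mul_of_one_le_left (by positivity) hΛsq
          have e3 : Λ * S ≤ Λ ^ 2 * ℓ * S := by
            exact mul_le_mul_of_nonneg_right (hΛle.trans (le_mul_of_one_le_right (sq_nonneg _) hℓ1)) hS0
          gcongr
          · exact hpS.trans e1
          · exact pow_le_one₀ hτ0.le hτ1'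
          · exact haS.trans e2
          · exact hcS.trans e3
      _ = M * Λ ^ 2 * ℓ * S := by rw [hM]; ring
  have hM0 : 0 ≤ M := by rw [hM]; positivity
  have hσℓ : Λ * τ * ℓ ^ 2 ≤ 4 := by
    rw [hℓ, hL]; exact mul_one_add_abs_log_sq_le (by positivity) hσ
  calc N' ≤ 2 * |p| * (τ * |G|) + 2 * |r| * (τ * |L| * |G|)
          + 4 * (κ * |c|) * τ * |a| := by
        rw [hN']
        refine (le_abs_self _).trans ((abs_add_le _ _).trans (add_le_add ((abs_sub _ _).trans ?_) ?_))
        · simp only [abs_mul, abs_of_pos hτ0]; norm_num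
        · simp only [abs_mul, abs_of_pos hτ0, abs_of_pos hκ0]; norm_num [mul_assoc]
    _ ≤ 2 * S * (τ * (M * Λ ^ 2 * ℓ * S)) + 2 * S * (τ * ℓ * (M * Λ ^ 2 * ℓ * S))
          + 4 * (Λ * S) * τ * (ℓ * S) := by gcongr
    _ ≤ 2 * S * (τ * (M * Λ ^ 2 * ℓ ^ 2 * S)) + 2 * S * (τ * ℓ * (M * Λ ^ 2 * ℓ * S))
          + 4 * (Λ ^ 2 * S) * τ * (ℓ ^ 2 * S) := by
        have : ℓ ≤ ℓ ^ 2 := le_self_pow₀ hℓ1 two_ne_zero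
        gcongr
    _ = 4 * (M + 1) * Λ * (Λ * τ * ℓ ^ 2) * S ^ 2 := by ring
    _ ≤ 4 * (M + 1) * Λ * 4 * S ^ 2 := by gcongr
    _ = 16 * (M + 1) * Λ * N := by rw [hSS]; ring

/-- The right-hand side of the energy estimate on `[1/Λ, 1]`, pointwise in `τ`. -/
theorem high_growth {K Λ κ τ φ₁ φ₂ φ₃ w w' a b c E : ℝ} (hK : 0 ≤ K) (hΛ : 1 ≤ Λ)
    (hΛκ : 1 ≤ Λ * κ) (hΛκ' : Λ * κ ≤ Λ ^ 2) (hτ0 : 0 < τ) (hτ1 : τ ≤ 1) (hΛτ : 1 ≤ Λ * τ)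
    (h1 : |φ₁| ≤ K) (h2 : |φ₂| ≤ K) (h3 : |φ₃| ≤ K) (hwτ : Λ ^ 2 ≤ w) (hw'0 : w' ≤ 0)
    (hab : Λ * |a * b| ≤ (b ^ 2 + w * a ^ 2) / 2)
    (hEτ : τ * (b ^ 2 + w * a ^ 2) / 2 + Λ * κ * c ^ 2 ≤ E) :
    2 * (τ * (b * (φ₁ * τ * b + φ₂ * τ ^ 2 * a + φ₃ * c))) + τ * w' * a ^ 2 - a * b / τ
      + a * (φ₁ * τ * b + φ₂ * τ ^ 2 * a + φ₃ * c) + 4 * (Λ * κ * τ * (c * a))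
      ≤ (1 / (Λ * τ ^ 2) + (17 * K + 6)) * E := by
  have hΛ0 : 0 < Λ := by linarith
  -- `17 K = 11 K + 6 K` comes from `t1` and `t2`, and `6` from `t3`.
  obtain ⟨A, hA⟩ : ∃ A, A = 17 * K + 6 := ⟨_, rfl⟩
  have hA0 : 0 ≤ A := by rw [hA]; positivity
  obtain ⟨F, hF⟩ : ∃ F, F = φ₁ * τ * b + φ₂ * τ ^ 2 * a + φ₃ * c := ⟨_, rfl⟩
  obtain ⟨E', hE'⟩ : ∃ E', E' = 2 * (τ * (b * F)) + τ * w' * a ^ 2 - a * b / τ + a * F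
    + 4 * (Λ * κ * τ * (c * a)) := ⟨_, rfl⟩
  rw [← hA, ← hF, ← hE']
  obtain ⟨D, hD⟩ : ∃ D, D = τ * (b ^ 2 + w * a ^ 2) / 2 + Λ * κ * c ^ 2 := ⟨_, rfl⟩
  rw [← hD] at hEτ
  have hwa : Λ ^ 2 * a ^ 2 ≤ w * a ^ 2 := by gcongr
  have hw0 : 0 ≤ w := (sq_nonneg Λ).trans hwτ
  have hD0 : 0 ≤ D := by rw [hD]; positivity
  have hκc : 0 ≤ Λ * κ * c ^ 2 := by positivity
  have hT : τ * b ^ 2 + τ * (w * a ^ 2) ≤ 2 * D := by rw [hD]; linarith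
  have hTb : 0 ≤ τ * b ^ 2 := by positivity
  have hTa : 0 ≤ τ * (w * a ^ 2) := by positivity
  have hb2 : τ * b ^ 2 ≤ 2 * D := by linarith
  have hΛa2 : τ * (Λ ^ 2 * a ^ 2) ≤ 2 * D := by
    have : τ * (Λ ^ 2 * a ^ 2) ≤ τ * (w * a ^ 2) := by gcongr
    linarith
  have ha2 : a ^ 2 ≤ 2 * D := by
    calc a ^ 2 ≤ (Λ * τ) ^ 2 * a ^ 2 :=
          le_mul_of_one_le_left (sq_nonneg _) (one_le_pow₀ hΛτ)
      _ = τ * (τ * (Λ ^ 2 * a ^ 2)) := by ring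
      _ ≤ 1 * (2 * D) := by gcongr
      _ = 2 * D := one_mul _
  have hκc2 : Λ * κ * c ^ 2 ≤ D := by
    have : 0 ≤ τ * (b ^ 2 + w * a ^ 2) / 2 := by positivity
    rw [hD]; linarith
  have hc2 : c ^ 2 ≤ D := (le_mul_of_one_le_left (sq_nonneg _) hΛκ).trans hκc2
  have hbc : τ * (|b| * |c|) ≤ 3 / 2 * D := by
    have : τ * c ^ 2 ≤ 1 * D := by gcongr
    linarith [mul_le_mul_of_nonneg_left (abs_mul_abs_le b c) hτ0.le]
  have hab2 : τ * (|a| * |b|) ≤ 2 * D := by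
    have : τ * a ^ 2 ≤ 1 * (2 * D) := by gcongr
    linarith [mul_le_mul_of_nonneg_left (abs_mul_abs_le a b) hτ0.le]
  have hac : |a| * |c| ≤ 3 / 2 * D := by
    linarith [abs_mul_abs_le a c]
  have hFle : |F| ≤ K * (τ * |b| + τ ^ 2 * |a| + |c|) := by
    calc |F| ≤ |φ₁| * τ * |b| + |φ₂| * τ ^ 2 * |a| + |φ₃| * |c| := by
          rw [hF]
          refine (abs_add_three _ _ _).trans ?_
          simp only [abs_mul, abs_of_nonneg (sq_nonneg τ), abs_of_pos hτ0]; rfl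
      _ ≤ K * τ * |b| + K * τ ^ 2 * |a| + K * |c| := by gcongr
      _ = _ := by ring
  have t1 : 2 * (τ * (b * F)) ≤ 11 * K * D := by
    calc 2 * (τ * (b * F)) ≤ 2 * (τ * (|b| * |F|)) := by
          rw [← abs_mul]; gcongr; exact le_abs_self _
      _ ≤ 2 * (τ * (|b| * (K * (τ * |b| + τ ^ 2 * |a| + |c|)))) := by gcongr
      _ = 2 * K * (τ * (τ * b ^ 2) + τ ^ 2 * (τ * (|a| * |b|)) + τ * (|b| * |c|)) := by
          rw [← sq_abs (b)]; ring
      _ ≤ 2 * K * (1 * (2 * D) + 1 * (2 * D) + 3 / 2 * D) := by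
          gcongr
          exact pow_le_one₀ hτ0.le hτ1
      _ = 11 * K * D := by ring
  have t2 : a * F ≤ 6 * K * D := by
    calc a * F ≤ |a| * |F| := by rw [← abs_mul]; exact le_abs_self _
      _ ≤ |a| * (K * (τ * |b| + τ ^ 2 * |a| + |c|)) := by gcongr
      _ = K * (τ * (|a| * |b|) + τ ^ 2 * a ^ 2 + |a| * |c|) := by
          rw [← sq_abs (a)]; ring
      _ ≤ K * (2 * D + 1 * (2 * D) + 3 / 2 * D) := by
          gcongr
          exact pow_le_one₀ hτ0.le hτ1
      _ ≤ 6 * K * D := by linarith [mul_nonneg hK hD0]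
  have t3 : 4 * (Λ * κ * τ * (c * a)) ≤ 6 * D := by
    have e1 : c * a ≤ (c ^ 2 + a ^ 2) / 2 := by nlinarith [sq_nonneg (c - a)]
    calc 4 * (Λ * κ * τ * (c * a)) ≤ 4 * (Λ * κ * τ * ((c ^ 2 + a ^ 2) / 2)) := by gcongr
      _ = 2 * (τ * (Λ * κ * c ^ 2) + τ * (Λ * κ * a ^ 2)) := by ring
      _ ≤ 2 * (1 * D + τ * (Λ ^ 2 * a ^ 2)) := by gcongr
      _ ≤ 2 * (1 * D + 2 * D) := by gcongr
      _ = 6 * D := by ring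
  have t4 : τ * w' * a ^ 2 ≤ 0 := by
    exact mul_nonpos_of_nonpos_of_nonneg (mul_nonpos_of_nonneg_of_nonpos hτ0.le hw'0)
      (sq_nonneg _)
  -- The only term not bounded by a constant rate; since `Λ |a b|` is below the energy density, its
  -- rate is `1 / (Λ τ²)`, integrable uniformly in `Λ`.
  have t5 : -(a * b / τ) ≤ 1 / (Λ * τ ^ 2) * D := by
    have e1 : Λ * τ * |a * b| ≤ D := by
      calc Λ * τ * |a * b| = τ * (Λ * |a * b|) := by ring
        _ ≤ τ * ((b ^ 2 + w * a ^ 2) / 2) := by gcongr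
        _ ≤ D := by rw [hD]; linarith
    calc -(a * b / τ) = -(a * b) / τ := by ring
      _ ≤ |a * b| / τ := by gcongr; exact neg_le_abs _
      _ = 1 / (Λ * τ ^ 2) * (Λ * τ * |a * b|) := by field_simp
      _ ≤ 1 / (Λ * τ ^ 2) * D := by gcongr
  calc E' ≤ (1 / (Λ * τ ^ 2) + A) * D := by
        rw [hE', hA]; linarith
    _ ≤ (1 / (Λ * τ ^ 2) + A) * E := by gcongr

section Mode

variable {q lam K Λ κ : ℝ} {f₁ f₂ f₃ a b b' c : ℝ → ℝ}

/-- Growth estimate on `(0, 1/Λ]`, in the variables `p = τ a'` and `r = a - p log (Λ τ)`. -/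
theorem IsModeSolution.low_estimate (hS : IsModeSolution q lam f₁ f₂ f₃ a b b' c)
    (hq : 1 ≤ q) (hK : 0 ≤ K) (hf : ∀ τ ∈ Ioc (0 : ℝ) 1, |f₁ τ| ≤ K ∧ |f₂ τ| ≤ K ∧ |f₃ τ| ≤ K)
    (hΛ : 1 ≤ Λ) (hΛlam : Λ ^ 2 = 1 + lam ^ 2) (hκ : Λ⁻¹ ≤ κ) (hκ' : κ ≤ Λ) {p₀ r₀ c₀ : ℝ}
    (hp : Tendsto (fun τ => τ * b τ) (𝓝[>] 0) (𝓝 p₀))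
    (hr : Tendsto (fun τ => a τ - τ * b τ * Real.log (Λ * τ)) (𝓝[>] 0) (𝓝 r₀))
    (hc : Tendsto c (𝓝[>] 0) (𝓝 c₀)) :
    (Λ⁻¹ * b Λ⁻¹) ^ 2 + a Λ⁻¹ ^ 2 + κ * c Λ⁻¹ ^ 2
      ≤ Real.exp (16 * (4 * q + 3 * K + 1)) * (p₀ ^ 2 + r₀ ^ 2 + κ * c₀ ^ 2) := by
  have hΛ0 : 0 < Λ := by linarith
  have hκ0 : 0 < κ := (inv_pos.2 hΛ0).trans_le hκ
  set M := 4 * q + 3 * K with hM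
  set B := 16 * (M + 1) with hB
  set p : ℝ → ℝ := fun τ => τ * b τ with hpdef
  set r : ℝ → ℝ := fun τ => a τ - τ * b τ * Real.log (Λ * τ) with hrdef
  set G : ℝ → ℝ := fun τ => -(modeWeight q lam τ * a τ)
    + (f₁ τ * p τ + f₂ τ * τ ^ 2 * a τ + f₃ τ * c τ) with hG
  have hp' : ∀ τ, 0 < τ → HasDerivAt p (τ * G τ) τ := by
    intro τ hτ
    refine ((hasDerivAt_id' τ).mul (hS.deriv_b τ hτ)).congr_deriv ?_
    simp only [hG, hpdef, hS.eq τ hτ]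
    field_simp
    ring
  have hr' : ∀ τ, 0 < τ → HasDerivAt r (-(τ * Real.log (Λ * τ) * G τ)) τ := by
    intro τ hτ
    have hl : HasDerivAt (fun τ => Real.log (Λ * τ)) (1 / τ) τ := by
      refine (((hasDerivAt_id' τ).const_mul Λ).log (by positivity)).congr_deriv ?_
      field_simp
    refine ((hS.deriv_a τ hτ).sub ((hp' τ hτ).mul hl)).congr_deriv ?_
    simp only [hpdef]
    field_simp
    ring
  set N : ℝ → ℝ := fun τ => p τ ^ 2 + r τ ^ 2 + κ * c τ ^ 2 with hN
  set N' : ℝ → ℝ := fun τ => 2 * p τ * (τ * G τ) - 2 * r τ * (τ * Real.log (Λ * τ) * G τ)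
    + 4 * κ * c τ * τ * a τ with hN'
  have hNd : ∀ τ, 0 < τ → HasDerivAt N (N' τ) τ := by
    intro τ hτ
    refine ((((hp' τ hτ).pow 2).add ((hr' τ hτ).pow 2)).add
      (((hS.deriv_c τ hτ).pow 2).const_mul κ)).congr_deriv ?_
    simp only [hN']; push_cast; ring
  have hbound : ∀ τ ∈ Ioc 0 Λ⁻¹, N' τ ≤ B * Λ * N τ := by
    intro τ hτ
    obtain ⟨hτ0, hτ1⟩ := hτ
    have hσ : Λ * τ ≤ 1 := by
      calc Λ * τ ≤ Λ * Λ⁻¹ := by gcongr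
        _ = 1 := by field_simp
    have hτ1' : τ ≤ 1 := hτ1.trans (inv_le_one_of_one_le₀ hΛ)
    obtain ⟨h1, h2, h3⟩ := hf τ ⟨hτ0, hτ1'⟩
    have hw0 : 0 ≤ modeWeight q lam τ := by unfold modeWeight; positivity
    have hw : modeWeight q lam τ ≤ 4 * q * Λ ^ 2 := hΛlam ▸ modeWeight_le hq
    exact low_growth hK hq hΛ hκ hκ' hτ0 hσ h1 h2 h3 hw0 hw
      (show a τ = r τ + p τ * _ by simp only [hrdef, hpdef]; ring)
  -- Integrating factor for the rate `B Λ`; at `τ = Λ⁻¹` its exponent is `-B`, whatever `Λ` is.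
  have hexp : ∀ τ, HasDerivAt (fun τ => Real.exp (-(B * Λ * τ)))
      (Real.exp (-(B * Λ * τ)) * -(B * Λ)) τ := by
    intro τ
    have := (((hasDerivAt_id τ).const_mul (B * Λ)).neg).exp
    simpa using this
  have key := le_lim_of_deriv_nonpos (f := fun τ => N τ * Real.exp (-(B * Λ * τ)))
    (l := (p₀ ^ 2 + r₀ ^ 2 + κ * c₀ ^ 2) * 1) (inv_pos.2 hΛ0)
    (fun τ hτ => (hNd τ hτ).mul (hexp τ))
    (fun τ hτ => by
      have := hbound τ hτ
      have he := Real.exp_pos (-(B * Λ * τ))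
      nlinarith [mul_le_mul_of_nonneg_right this he.le])
    (by
      refine Tendsto.mul (((hp.pow 2).add (hr.pow 2)).add ((hc.pow 2).const_mul κ)) ?_
      have : Tendsto (fun τ => Real.exp (-(B * Λ * τ))) (𝓝 0) (𝓝 1) := by
        have := (hexp 0).continuousAt.tendsto
        simpa using this
      exact this.mono_left nhdsWithin_le_nhds)
  have e1 : B * Λ * Λ⁻¹ = B := by field_simp
  -- At `τ = Λ⁻¹` the logarithm vanishes, hence `r = a` there.
  have hNΛ : N Λ⁻¹ = (Λ⁻¹ * b Λ⁻¹) ^ 2 + a Λ⁻¹ ^ 2 + κ * c Λ⁻¹ ^ 2 := by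
    simp only [hN, hpdef, hrdef, mul_inv_cancel₀ hΛ0.ne', Real.log_one, mul_zero, sub_zero]
  simp only [e1, mul_one, Real.exp_neg] at key
  rw [← hNΛ, mul_comm]
  rwa [← div_eq_mul_inv, div_le_iff₀ (Real.exp_pos _)] at key

/-- Energy estimate on `[1/Λ, 1]`. -/
theorem IsModeSolution.high_estimate (hS : IsModeSolution q lam f₁ f₂ f₃ a b b' c)
    (hq : 1 ≤ q) (hK : 0 ≤ K) (hf : ∀ τ ∈ Ioc (0 : ℝ) 1, |f₁ τ| ≤ K ∧ |f₂ τ| ≤ K ∧ |f₃ τ| ≤ K)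
    (hΛ : 1 ≤ Λ) (hΛlam : Λ ^ 2 = 1 + lam ^ 2) (hκ : Λ⁻¹ ≤ κ) (hκ' : κ ≤ Λ) :
    Λ * a 1 ^ 2 + Λ⁻¹ * b 1 ^ 2 + κ * c 1 ^ 2
      ≤ 10 * q * Real.exp (17 * K + 7)
        * ((Λ⁻¹ * b Λ⁻¹) ^ 2 + a Λ⁻¹ ^ 2 + κ * c Λ⁻¹ ^ 2) := by
  have hΛ0 : 0 < Λ := by linarith
  have hκ0 : 0 < κ := (inv_pos.2 hΛ0).trans_le hκ
  have hΛκ : 1 ≤ Λ * κ := by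
    calc 1 = Λ * Λ⁻¹ := by field_simp
      _ ≤ Λ * κ := by gcongr
  have hΛκ' : Λ * κ ≤ Λ ^ 2 := by nlinarith
  set A := 17 * K + 6 with hA
  set w := modeWeight q lam with hw
  set w' : ℝ → ℝ := fun τ => -(16 * τ * lam ^ 2 / (τ ^ 2 + 1) ^ 3) with hw'
  set F : ℝ → ℝ := fun τ => f₁ τ * τ * b τ + f₂ τ * τ ^ 2 * a τ + f₃ τ * c τ with hF
  -- Differentiating `τ (b² + w a²)` leaves `w a² - b²`; differentiating `a b` produces the
  -- opposite, plus the harmless `-a b / τ` and forcing.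
  set E : ℝ → ℝ := fun τ => τ * (b τ ^ 2 + w τ * a τ ^ 2) + a τ * b τ + Λ * κ * c τ ^ 2 with hE
  set E' : ℝ → ℝ := fun τ => 2 * (τ * (b τ * F τ)) + τ * w' τ * a τ ^ 2 - a τ * b τ / τ
    + a τ * F τ + 4 * (Λ * κ * τ * (c τ * a τ)) with hE'
  have hEd : ∀ τ, 0 < τ → HasDerivAt E (E' τ) τ := by
    intro τ hτ
    have ha := hS.deriv_a τ hτ
    have hb := hS.deriv_b τ hτ
    refine ((((hasDerivAt_id' τ).mul ((hb.pow 2).add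
      ((hasDerivAt_modeWeight q lam τ).mul (ha.pow 2)))).add (ha.mul hb)).add
      (((hS.deriv_c τ hτ).pow 2).const_mul (Λ * κ))).congr_deriv ?_
    simp only [hE', hF, hw', hS.eq τ hτ, Pi.pow_apply, Pi.add_apply, Pi.mul_apply]
    push_cast
    field_simp
    ring
  have hcoer : ∀ τ ∈ Icc Λ⁻¹ 1, 0 < τ ∧ τ ≤ 1 ∧ 1 ≤ Λ * τ ∧ Λ ^ 2 ≤ w τ ∧
      Λ * |a τ * b τ| ≤ (b τ ^ 2 + w τ * a τ ^ 2) / 2 ∧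
      τ * (b τ ^ 2 + w τ * a τ ^ 2) / 2 + Λ * κ * c τ ^ 2 ≤ E τ := by
    intro τ hτ
    have hτ0 : 0 < τ := (inv_pos.2 hΛ0).trans_le hτ.1
    have h1 : 1 ≤ Λ * τ := by
      calc 1 = Λ * Λ⁻¹ := by field_simp
        _ ≤ Λ * τ := by gcongr; exact hτ.1
    have hwτ : Λ ^ 2 ≤ w τ := hΛlam ▸ le_modeWeight hq hτ0.le hτ.2
    have hab : Λ * |a τ * b τ| ≤ (b τ ^ 2 + w τ * a τ ^ 2) / 2 := by
      have e1 : Λ ^ 2 * a τ ^ 2 ≤ w τ * a τ ^ 2 := by gcongr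
      rw [abs_mul]
      nlinarith [sq_nonneg (Λ * |a τ| - |b τ|), sq_abs (a τ), sq_abs (b τ)]
    refine ⟨hτ0, hτ.2, h1, hwτ, hab, ?_⟩
    have : |a τ * b τ| ≤ τ * (b τ ^ 2 + w τ * a τ ^ 2) / 2 := by
      calc |a τ * b τ| ≤ (Λ * τ) * |a τ * b τ| := le_mul_of_one_le_left (abs_nonneg _) h1
        _ = τ * (Λ * |a τ * b τ|) := by ring
        _ ≤ τ * ((b τ ^ 2 + w τ * a τ ^ 2) / 2) := by gcongr
        _ = _ := by ring
    simp only [hE]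
    linarith [neg_abs_le (a τ * b τ)]
  have hbound : ∀ τ ∈ Icc Λ⁻¹ 1, E' τ ≤ (1 / (Λ * τ ^ 2) + A) * E τ := by
    intro τ hτ
    obtain ⟨hτ0, hτ1, hΛτ, hwτ, hab, hEτ⟩ := hcoer τ hτ
    obtain ⟨h1, h2, h3⟩ := hf τ ⟨hτ0, hτ1⟩
    have hw'0 : w' τ ≤ 0 := by
      have : 0 ≤ 16 * τ * lam ^ 2 / (τ ^ 2 + 1) ^ 3 := by positivity
      simp only [hw']; linarith
    exact high_growth hK hΛ hΛκ hΛκ' hτ0 hτ1 hΛτ h1 h2 h3 hwτ hw'0 hab hEτ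
  -- The exponent is minus a primitive of `1 / (Λ τ²) + A`; the singular part equals `1` at `τ =
  -- Λ⁻¹`, whence the factor `exp (1 + A) = exp (17 K + 7)`.
  have hexp : ∀ τ, 0 < τ → HasDerivAt (fun τ => Real.exp (1 / (Λ * τ) - A * τ))
      (Real.exp (1 / (Λ * τ) - A * τ) * (-(1 / (Λ * τ ^ 2)) - A)) τ := by
    intro τ hτ
    have h1 : HasDerivAt (fun τ : ℝ => 1 / (Λ * τ)) (-(1 / (Λ * τ ^ 2))) τ := by
      refine ((hasDerivAt_const τ (1 : ℝ)).div ((hasDerivAt_id' τ).const_mul Λ)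
        (by positivity)).congr_deriv ?_
      field_simp; ring
    have := (h1.sub ((hasDerivAt_id τ).const_mul A)).exp
    simpa using this
  have key := le_of_deriv_nonpos (f := fun τ => E τ * Real.exp (1 / (Λ * τ) - A * τ))
    (inv_pos.2 hΛ0) (inv_le_one_of_one_le₀ hΛ)
    (fun τ hτ => (hEd τ hτ).mul (hexp τ hτ))
    (fun τ hτ => by
      have := hbound τ hτ
      have he := Real.exp_pos (1 / (Λ * τ) - A * τ)
      nlinarith [mul_le_mul_of_nonneg_right this he.le])
  obtain ⟨-, -, -, hw1, -, hE1⟩ := hcoer 1 ⟨inv_le_one_of_one_le₀ hΛ, le_rfl⟩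
  set N := (Λ⁻¹ * b Λ⁻¹) ^ 2 + a Λ⁻¹ ^ 2 + κ * c Λ⁻¹ ^ 2 with hN
  have hN0 : 0 ≤ N := by positivity
  have hA0 : 0 ≤ A := by positivity
  -- With `b = Λ P`, every term of the energy at `τ = Λ⁻¹` carries exactly one factor `Λ`; `4 q`
  -- comes from the weight and the rest of `5 q` from the cross term.
  have hEΛ : E Λ⁻¹ ≤ 5 * q * Λ * N := by
    set P := Λ⁻¹ * b Λ⁻¹ with hP
    have hbP : b Λ⁻¹ = Λ * P := by simp only [hP]; field_simp
    have hwΛ : w Λ⁻¹ ≤ 4 * q * Λ ^ 2 := hΛlam ▸ modeWeight_le hq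
    have e1 : E Λ⁻¹ ≤ Λ⁻¹ * ((Λ * P) ^ 2 + 4 * q * Λ ^ 2 * a Λ⁻¹ ^ 2) + a Λ⁻¹ * (Λ * P)
        + Λ * κ * c Λ⁻¹ ^ 2 := by
      simp only [hE]; rw [hbP]; gcongr
    have e2 : Λ⁻¹ * ((Λ * P) ^ 2 + 4 * q * Λ ^ 2 * a Λ⁻¹ ^ 2) + a Λ⁻¹ * (Λ * P)
        + Λ * κ * c Λ⁻¹ ^ 2 = Λ * (P ^ 2 + 4 * q * a Λ⁻¹ ^ 2 + a Λ⁻¹ * P + κ * c Λ⁻¹ ^ 2) := by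
      field_simp
    have e3 : P ^ 2 + 4 * q * a Λ⁻¹ ^ 2 + a Λ⁻¹ * P + κ * c Λ⁻¹ ^ 2 ≤ 5 * q * N := by
      have : 0 ≤ κ * c Λ⁻¹ ^ 2 := by positivity
      have g1 : P ^ 2 ≤ q * P ^ 2 := le_mul_of_one_le_left (sq_nonneg _) hq
      have g2 : a Λ⁻¹ ^ 2 ≤ q * a Λ⁻¹ ^ 2 := le_mul_of_one_le_left (sq_nonneg _) hq
      have g3 : κ * c Λ⁻¹ ^ 2 ≤ q * (κ * c Λ⁻¹ ^ 2) := le_mul_of_one_le_left this hq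
      simp only [hN]
      nlinarith [sq_nonneg (P - a Λ⁻¹), sq_nonneg P, sq_nonneg (a Λ⁻¹)]
    calc E Λ⁻¹ ≤ Λ * (5 * q * N) := by rw [e2] at e1; exact e1.trans (by gcongr)
      _ = _ := by ring
  have hkey : E 1 ≤ Real.exp (17 * K + 7) * (5 * q * Λ * N) := by
    have e1 : 1 / (Λ * Λ⁻¹) = 1 := by field_simp
    simp only [e1, mul_one] at key
    have e2 : E 1 * Real.exp (1 / Λ - A) ≤ 5 * q * Λ * N * Real.exp 1 := by
      refine key.trans ?_
      have : 0 ≤ A * Λ⁻¹ := by positivity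
      gcongr
      linarith
    have hE10 : 0 ≤ E 1 := le_trans (by
      have : 0 ≤ w 1 := (sq_nonneg Λ).trans hw1
      positivity) hE1
    have e3 : E 1 * Real.exp (-A) ≤ 5 * q * Λ * N * Real.exp 1 := by
      refine le_trans ?_ e2
      have : 0 ≤ 1 / Λ := by positivity
      gcongr
      linarith
    have e4 := mul_le_mul_of_nonneg_right e3 (Real.exp_pos A).le
    rw [mul_assoc, ← Real.exp_add, mul_assoc, ← Real.exp_add, neg_add_cancel, Real.exp_zero,
      mul_one] at e4
    calc E 1 ≤ 5 * q * Λ * N * Real.exp (1 + A) := e4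
      _ = _ := by rw [hA, mul_comm]; congr 2; ring
  have hfin : Λ * (Λ * a 1 ^ 2 + Λ⁻¹ * b 1 ^ 2 + κ * c 1 ^ 2) ≤ 2 * E 1 := by
    have e1 : Λ ^ 2 * a 1 ^ 2 ≤ w 1 * a 1 ^ 2 := by gcongr
    have e2 : Λ * (Λ * a 1 ^ 2 + Λ⁻¹ * b 1 ^ 2 + κ * c 1 ^ 2)
        = Λ ^ 2 * a 1 ^ 2 + b 1 ^ 2 + Λ * κ * c 1 ^ 2 := by field_simp
    have e3 : 0 ≤ Λ * κ * c 1 ^ 2 := by positivity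
    rw [e2]; linarith
  have : Λ * (Λ * a 1 ^ 2 + Λ⁻¹ * b 1 ^ 2 + κ * c 1 ^ 2)
      ≤ Λ * (10 * q * Real.exp (17 * K + 7) * N) := by
    refine hfin.trans ((mul_le_mul_of_nonneg_left hkey zero_le_two).trans (le_of_eq (by ring)))
  exact le_of_mul_le_mul_left this hΛ0

end Mode

/-- The estimate for a single mode, uniform in the frequency. -/
theorem mode_estimate {q : ℝ} (hq : 1 ≤ q) {K : ℝ} (hK : 0 ≤ K) :
    ∃ C : ℝ, 0 ≤ C ∧ ∀ (lam Λ κ : ℝ) (f₁ f₂ f₃ a b b' c : ℝ → ℝ),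
      IsModeSolution q lam f₁ f₂ f₃ a b b' c →
      (∀ τ ∈ Ioc (0 : ℝ) 1, |f₁ τ| ≤ K ∧ |f₂ τ| ≤ K ∧ |f₃ τ| ≤ K) →
      1 ≤ Λ → Λ ^ 2 = 1 + lam ^ 2 → Λ⁻¹ ≤ κ → κ ≤ Λ → ∀ p₀ r₀ c₀ : ℝ,
      Tendsto (fun τ => τ * b τ) (𝓝[>] 0) (𝓝 p₀) →
      Tendsto (fun τ => a τ - τ * b τ * Real.log (Λ * τ)) (𝓝[>] 0) (𝓝 r₀) →
      Tendsto c (𝓝[>] 0) (𝓝 c₀) →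
      Λ * a 1 ^ 2 + Λ⁻¹ * b 1 ^ 2 + κ * c 1 ^ 2 ≤ C * (p₀ ^ 2 + r₀ ^ 2 + κ * c₀ ^ 2) := by
  refine ⟨10 * q * Real.exp (17 * K + 7) * Real.exp (16 * (4 * q + 3 * K + 1)), by positivity, ?_⟩
  intro lam Λ κ f₁ f₂ f₃ a b b' c hS hf hΛ hΛlam hκ hκ' p₀ r₀ c₀ hp hr hc
  refine (hS.high_estimate hq hK hf hΛ hΛlam hκ hκ').trans ?_
  exact (mul_le_mul_of_nonneg_left (hS.low_estimate hq hK hf hΛ hΛlam hκ hκ' hp hr hc)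
    (by positivity)).trans_eq (by ring)

/-! ### Extensions constant along rays and their smoothness -/

section Radial

variable {n : ℕ}

local notation "𝔼" => EuclideanSpace ℝ (Fin (n + 1))

/-- Radial projection of `ℝ^(n+1) ∖ {0}` to the sphere (with a junk value at the origin). -/
noncomputable def radialProj (y : EuclideanSpace ℝ (Fin (n + 1))) : Sph n :=
  if hy : y = 0 then ⟨EuclideanSpace.single 0 1, by simp⟩
  else ⟨‖y‖⁻¹ • y, by
    rw [mem_sphere_zero_iff_norm, norm_smul, norm_inv, norm_norm,
      inv_mul_cancel₀ (norm_ne_zero_iff.mpr hy)]⟩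

theorem coe_radialProj {y : 𝔼} (hy : y ≠ 0) : (radialProj y : 𝔼) = ‖y‖⁻¹ • y := by
  simp [radialProj, hy]

theorem ext_eq (f : Sph n → ℝ) {y : 𝔼} (hy : y ≠ 0) : ext f y = f (radialProj y) := by
  simp [ext, radialProj, hy]

theorem sph_ne_zero (x : Sph n) : (x : 𝔼) ≠ 0 := ne_zero_of_mem_unit_sphere x

theorem radialProj_coe (x : Sph n) : radialProj (x : 𝔼) = x := by
  apply Subtype.ext
  rw [coe_radialProj (sph_ne_zero x), norm_eq_of_mem_sphere, inv_one, one_smul]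

theorem radialProj_smul {c : ℝ} (hc : 0 < c) {y : 𝔼} (hy : y ≠ 0) :
    radialProj (c • y) = radialProj y := by
  apply Subtype.ext
  rw [coe_radialProj (smul_ne_zero hc.ne' hy), coe_radialProj hy, norm_smul, smul_smul,
    Real.norm_of_nonneg hc.le]
  congr 1
  field_simp

@[simp] theorem ext_coe (f : Sph n → ℝ) (x : Sph n) : ext f (x : 𝔼) = f x := by
  rw [ext_eq f (sph_ne_zero x), radialProj_coe]

theorem ext_smul (f : Sph n → ℝ) {c : ℝ} (hc : 0 < c) {y : 𝔼} (hy : y ≠ 0) :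
    ext f (c • y) = ext f y := by
  rw [ext_eq f (smul_ne_zero hc.ne' hy), ext_eq f hy, radialProj_smul hc hy]

/-- Restricting the codomain to the sphere needs a map smooth on the whole space. So `y` is replaced
by `w y`, which agrees with `y` near `y₀` and never vanishes because it stays at distance less than
`‖y₀‖` from `y₀`. -/
theorem contMDiffAt_radialProj {y₀ : 𝔼} (hy₀ : y₀ ≠ 0) :
    ContMDiffAt 𝓘(ℝ, 𝔼) (𝓡 n) ∞ (radialProj : 𝔼 → Sph n) y₀ := by
  have hpos : 0 < ‖y₀‖ := norm_pos_iff.2 hy₀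
  let b : ContDiffBump y₀ := ⟨‖y₀‖ / 4, ‖y₀‖ / 2, by positivity, by linarith⟩
  let w : 𝔼 → 𝔼 := fun y => y₀ + b y • (y - y₀)
  have hw : ContDiff ℝ ∞ w := contDiff_const.add (b.contDiff.smul (contDiff_id.sub contDiff_const))
  have hw0 : ∀ y, w y ≠ 0 := by
    intro y h
    have h1 : ‖b y • (y - y₀)‖ = ‖y₀‖ := by
      rw [← norm_neg y₀]; congr 1
      exact eq_neg_of_add_eq_zero_right h
    have h2 : ‖b y • (y - y₀)‖ < ‖y₀‖ := by
      rw [norm_smul, Real.norm_of_nonneg b.nonneg]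
      by_cases hy : dist y y₀ < ‖y₀‖ / 2
      · calc b y * ‖y - y₀‖ ≤ 1 * ‖y - y₀‖ := by gcongr; exact b.le_one
          _ < ‖y₀‖ := by rw [one_mul, ← dist_eq_norm]; linarith
      · rw [b.zero_of_le_dist (not_lt.1 hy), zero_mul]; exact hpos
    exact h2.ne h1
  have hg : ContDiff ℝ ∞ (fun y => ‖w y‖⁻¹ • w y) :=
    ((hw.norm ℝ hw0).inv (fun y => norm_ne_zero_iff.2 (hw0 y))).smul hw
  have hg1 : ∀ y, ‖w y‖⁻¹ • w y ∈ Metric.sphere (0 : 𝔼) 1 := by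
    intro y
    rw [mem_sphere_zero_iff_norm, norm_smul, norm_inv, norm_norm,
      inv_mul_cancel₀ (norm_ne_zero_iff.mpr (hw0 y))]
  have := Fact.mk (@finrank_euclideanSpace_fin ℝ _ (n + 1))
  refine ((ContMDiff.codRestrict_sphere (n := n) hg.contMDiff hg1).contMDiffAt).congr_of_eventuallyEq ?_
  filter_upwards [b.eventuallyEq_one, isOpen_ne.mem_nhds hy₀] with y hy hy0
  apply Subtype.ext
  rw [coe_radialProj hy0]
  have hwy : w y = y := by simp [w, hy]
  rw [Set.val_codRestrict_apply, hwy]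

/-- The extension of a smooth function is smooth away from the origin. -/
theorem IsSmooth.contDiffOn_ext {f : Sph n → ℝ} (hf : IsSmooth f) :
    ContDiffOn ℝ ∞ (ext f) {0}ᶜ := by
  intro y hy
  have h : ContMDiffAt 𝓘(ℝ, 𝔼) 𝓘(ℝ, ℝ) ∞ (f ∘ radialProj) y :=
    (hf.contMDiffAt).comp y (contMDiffAt_radialProj hy)
  refine (h.contDiffAt.congr_of_eventuallyEq ?_).contDiffWithinAt
  filter_upwards [isOpen_ne.mem_nhds hy] with z hz using ext_eq f hz

/-- Smoothness on spacetime, in terms of the extension that is constant along rays. -/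
def ExtSmooth (u : ℝ → Sph n → ℝ) : Prop :=
  ContDiffOn ℝ ∞ (fun p : ℝ × 𝔼 => ext (u p.1) p.2) (Ioi 0 ×ˢ {0}ᶜ)

theorem isOpen_spacetime : IsOpen ((Ioi 0 ×ˢ {0}ᶜ : Set (ℝ × 𝔼))) :=
  isOpen_Ioi.prod isOpen_compl_singleton

theorem IsSmoothSpacetime.extSmooth {u : ℝ → Sph n → ℝ} (hu : IsSmoothSpacetime u) :
    ExtSmooth u := by
  rintro ⟨τ, y⟩ ⟨hτ, hy⟩
  have h1 : ContMDiffAt 𝓘(ℝ, ℝ × 𝔼) (𝓘(ℝ, ℝ).prod (𝓡 n)) ∞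
      (fun p : ℝ × 𝔼 => (p.1, radialProj p.2)) (τ, y) := by
    refine ContMDiffAt.prodMk contDiff_fst.contMDiff.contMDiffAt ?_
    exact ContMDiffAt.comp (τ, y) (contMDiffAt_radialProj hy) contDiff_snd.contMDiff.contMDiffAt
  have h2 : ContMDiffAt (𝓘(ℝ, ℝ).prod (𝓡 n)) 𝓘(ℝ, ℝ) ∞
      (fun p : ℝ × Sph n => u p.1 p.2) (τ, radialProj y) :=
    hu.contMDiffAt ((isOpen_Ioi.prod isOpen_univ).mem_nhds ⟨hτ, mem_univ _⟩)
  have h := ContMDiffAt.comp (τ, y) h2 h1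
  refine (h.contDiffAt.congr_of_eventuallyEq ?_).contDiffWithinAt
  filter_upwards [isOpen_spacetime.mem_nhds (Set.mk_mem_prod hτ hy)] with z hz using ext_eq _ hz.2

namespace ExtSmooth

variable {u : ℝ → Sph n → ℝ} (hu : ExtSmooth u)
include hu

theorem hasDerivAt_ext {τ : ℝ} (hτ : 0 < τ) {y : 𝔼} (hy : y ≠ 0) :
    HasDerivAt (fun t => ext (u t) y)
      (fderiv ℝ (fun p : ℝ × 𝔼 => ext (u p.1) p.2) (τ, y) (1, 0)) τ := by
  have h1 : DifferentiableAt ℝ (fun p : ℝ × 𝔼 => ext (u p.1) p.2) (τ, y) :=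
    (hu.contDiffAt (isOpen_spacetime.mem_nhds (Set.mk_mem_prod hτ hy))).differentiableAt (by simp)
  exact h1.hasFDerivAt.comp_hasDerivAt τ ((hasDerivAt_id' τ).prodMk (hasDerivAt_const τ y))

theorem hasDerivAt {τ : ℝ} (hτ : 0 < τ) (x : Sph n) :
    HasDerivAt (fun t => u t x) (dτ u τ x) τ := by
  have := (hu.hasDerivAt_ext hτ (sph_ne_zero x)).differentiableAt
  simp only [ext_coe] at this
  exact this.hasDerivAt

theorem ext_dτ {τ : ℝ} (hτ : 0 < τ) {y : 𝔼} (hy : y ≠ 0) :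
    ext (dτ u τ) y = fderiv ℝ (fun p : ℝ × 𝔼 => ext (u p.1) p.2) (τ, y) (1, 0) := by
  rw [ext_eq _ hy, ← (hu.hasDerivAt_ext hτ hy).deriv]
  simp only [ext_eq _ hy, dτ]

theorem dτ : ExtSmooth (dτ u) := by
  have h := (hu.fderiv_of_isOpen (m := ∞) isOpen_spacetime (by simp)).clm_apply
    (contDiffOn_const (c := ((1 : ℝ), (0 : 𝔼))))
  exact h.congr fun p hp => hu.ext_dτ hp.1 hp.2

theorem continuousOn : ContinuousOn (fun p : ℝ × Sph n => u p.1 p.2) (Ioi 0 ×ˢ univ) := by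
  have h : ContinuousOn (fun p : ℝ × Sph n => ext (u p.1) (p.2 : 𝔼)) (Ioi 0 ×ˢ univ) :=
    ContinuousOn.comp (f := fun p : ℝ × Sph n => (p.1, (p.2 : 𝔼)))
      (ContDiffOn.continuousOn hu) (by fun_prop) (fun p hp => Set.mk_mem_prod hp.1 (sph_ne_zero p.2))
  simpa using h

theorem contDiffOn_ext {τ : ℝ} (hτ : 0 < τ) : ContDiffOn ℝ ∞ (ext (u τ)) {0}ᶜ :=
  ContDiffOn.comp (f := fun y : 𝔼 => (τ, y)) hu (by fun_prop) (fun _ hy => Set.mk_mem_prod hτ hy)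

end ExtSmooth

theorem continuous_of_ext {f : Sph n → ℝ} (hf : ContinuousOn (ext f) {0}ᶜ) : Continuous f := by
  have : Continuous (fun x : Sph n => ext f (x : 𝔼)) :=
    hf.comp_continuous continuous_subtype_val sph_ne_zero
  simpa using this

end Radial

/-! ### Homogeneity and symmetry of the spherical Laplacian -/

section Symmetry

variable {n : ℕ}

local notation "𝔼" => EuclideanSpace ℝ (Fin (n + 1))

theorem fderiv_comp_smul_eq {F : Type*} [NormedAddCommGroup F] [NormedSpace ℝ F] (G : 𝔼 → F)
    {c : ℝ} {y : 𝔼} (hG : DifferentiableAt ℝ G (c • y)) :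
    fderiv ℝ (fun z => G (c • z)) y = c • fderiv ℝ G (c • y) := by
  have h : HasFDerivAt (fun z : 𝔼 => c • z) (c • ContinuousLinearMap.id ℝ 𝔼) y :=
    (hasFDerivAt_id y).const_smul c
  have := (hG.hasFDerivAt.comp y h).fderiv
  rw [Function.comp_def] at this
  rw [this]
  ext v
  simp

theorem laplacian_eq_sum (F : 𝔼 → ℝ) (y : 𝔼) :
    Laplacian.laplacian F y = ∑ i, fderiv ℝ (fderiv ℝ F) y
      (EuclideanSpace.basisFun (Fin (n + 1)) ℝ i) (EuclideanSpace.basisFun (Fin (n + 1)) ℝ i) := by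
  rw [InnerProductSpace.laplacian_eq_iteratedFDeriv_orthonormalBasis F
    (EuclideanSpace.basisFun (Fin (n + 1)) ℝ)]
  simp [iteratedFDeriv_two_apply]

section Homogeneous

variable {f : Sph n → ℝ} (hf : ContDiffOn ℝ ∞ (ext f) {0}ᶜ)
include hf

theorem contDiffOn_fderiv_ext : ContDiffOn ℝ ∞ (fderiv ℝ (ext f)) {0}ᶜ :=
  hf.fderiv_of_isOpen (m := ∞) isOpen_compl_singleton (by simp)

theorem differentiableAt_ext {y : 𝔼} (hy : y ≠ 0) : DifferentiableAt ℝ (ext f) y :=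
  (hf.contDiffAt (isOpen_compl_singleton.mem_nhds hy)).differentiableAt (by simp)

theorem differentiableAt_fderiv_ext {y : 𝔼} (hy : y ≠ 0) :
    DifferentiableAt ℝ (fderiv ℝ (ext f)) y :=
  ((contDiffOn_fderiv_ext hf).contDiffAt (isOpen_compl_singleton.mem_nhds hy)).differentiableAt
    (by simp)

theorem fderiv_ext_smul {c : ℝ} (hc : 0 < c) {y : 𝔼} (hy : y ≠ 0) :
    fderiv ℝ (ext f) (c • y) = c⁻¹ • fderiv ℝ (ext f) y := by
  have h1 : (fun z => ext f (c • z)) =ᶠ[𝓝 y] ext f := by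
    filter_upwards [isOpen_ne.mem_nhds hy] with z hz using ext_smul f hc hz
  have h2 := fderiv_comp_smul_eq (ext f) (differentiableAt_ext hf (smul_ne_zero hc.ne' hy))
  rw [h1.fderiv_eq] at h2
  rw [h2, smul_smul, inv_mul_cancel₀ hc.ne', one_smul]

theorem fderiv_fderiv_ext_smul {c : ℝ} (hc : 0 < c) {y : 𝔼} (hy : y ≠ 0) :
    fderiv ℝ (fderiv ℝ (ext f)) (c • y) = (c⁻¹ ^ 2) • fderiv ℝ (fderiv ℝ (ext f)) y := by
  have h1 : (fun z => fderiv ℝ (ext f) (c • z)) =ᶠ[𝓝 y] c⁻¹ • fderiv ℝ (ext f) := by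
    filter_upwards [isOpen_ne.mem_nhds hy] with z hz using fderiv_ext_smul hf hc hz
  have h2 := fderiv_comp_smul_eq (fderiv ℝ (ext f))
    (differentiableAt_fderiv_ext hf (smul_ne_zero hc.ne' hy))
  rw [h1.fderiv_eq, fderiv_const_smul (differentiableAt_fderiv_ext hf hy)] at h2
  have h3 := congrArg (fun L => c⁻¹ • L) h2
  simp only [smul_smul, inv_mul_cancel₀ hc.ne', one_smul] at h3
  rw [← h3, sq]

/-- The extension is homogeneous of degree `0`, so its second derivatives are homogeneous of degree
`-2`. -/
theorem laplacian_ext {y : 𝔼} (hy : y ≠ 0) :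
    Laplacian.laplacian (ext f) y = (‖y‖⁻¹ ^ 2) * ext (sphLap f) y := by
  have hpos : 0 < ‖y‖ := norm_pos_iff.2 hy
  have hy' : y = ‖y‖ • (radialProj y : 𝔼) := by
    rw [coe_radialProj hy, smul_smul, mul_inv_cancel₀ hpos.ne', one_smul]
  rw [ext_eq _ hy, sphLap, laplacian_eq_sum, laplacian_eq_sum]
  conv_lhs => rw [hy']
  rw [fderiv_fderiv_ext_smul hf hpos (sph_ne_zero _), Finset.mul_sum]
  simp

/-- Euler's identity in degree `0`: the gradient of the extension is tangential. -/
theorem fderiv_ext_self {y : 𝔼} (hy : y ≠ 0) : fderiv ℝ (ext f) y y = 0 := by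
  have h1 : HasDerivAt (fun t : ℝ => (1 + t) • y) y 0 := by
    simpa using (((hasDerivAt_id' (0 : ℝ)).const_add 1).smul_const y)
  have h2 : HasFDerivAt (ext f) (fderiv ℝ (ext f) y) ((1 + (0 : ℝ)) • y) := by
    rw [add_zero, one_smul]; exact (differentiableAt_ext hf hy).hasFDerivAt
  have h3 := h2.comp_hasDerivAt (0 : ℝ) h1
  have h4 : (ext f ∘ fun t : ℝ => (1 + t) • y) =ᶠ[𝓝 0] fun _ => ext f y := by
    filter_upwards [Ioi_mem_nhds (show (-1 : ℝ) < 0 by norm_num)] with t ht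
    have : (0 : ℝ) < 1 + t := by have := mem_Ioi.1 ht; linarith
    exact ext_smul f this hy
  exact h3.unique ((hasDerivAt_const (0 : ℝ) (ext f y)).congr_of_eventuallyEq h4)

theorem continuous_sphLap : Continuous (sphLap f) := by
  have h : ContinuousOn (fun y => Laplacian.laplacian (ext f) y) {0}ᶜ := by
    have h2 := ((contDiffOn_fderiv_ext hf).fderiv_of_isOpen (m := ∞) isOpen_compl_singleton
      (by simp)).continuousOn
    simp only [laplacian_eq_sum]
    fun_prop
  exact h.comp_continuous continuous_subtype_val sph_ne_zero

end Homogeneous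

instance isFiniteMeasure_sphVol (n : ℕ) : IsFiniteMeasure (sphVol n) :=
  inferInstanceAs (IsFiniteMeasure (volume : Measure (EuclideanSpace ℝ (Fin (n + 1)))).toSphere)

/-- Polar coordinates for the product of a radial function and a function that is constant along
rays. -/
theorem integral_radial_mul_ext (k : ℝ → ℝ) (W : Sph n → ℝ) :
    ∫ y : 𝔼, k ‖y‖ * ext W y = (∫ x, W x ∂sphVol n)
      * ∫ r : Ioi (0 : ℝ), k r ∂Measure.volumeIoiPow (Module.finrank ℝ 𝔼 - 1) := by
  have hpol : ∀ y : ({0}ᶜ : Set 𝔼), k ‖(y : 𝔼)‖ * ext W (y : 𝔼)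
      = (fun p : Sph n × Ioi (0 : ℝ) => W p.1 * k p.2) (homeomorphUnitSphereProd 𝔼 y) := by
    intro y
    have hy : (y : 𝔼) ≠ 0 := y.2
    have h1 : (homeomorphUnitSphereProd 𝔼 y).1 = radialProj (y : 𝔼) := by
      apply Subtype.ext
      rw [coe_radialProj hy, homeomorphUnitSphereProd_apply_fst_coe]
    simp only [homeomorphUnitSphereProd_apply_snd_coe, h1, ext_eq W hy]
    exact mul_comm _ _
  calc ∫ y : 𝔼, k ‖y‖ * ext W y
      = ∫ y : ({0}ᶜ : Set 𝔼), k ‖(y : 𝔼)‖ * ext W (y : 𝔼) ∂((volume : Measure 𝔼).comap (↑)) := by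
        rw [integral_subtype_comap (measurableSet_singleton _).compl fun y : 𝔼 => k ‖y‖ * ext W y,
          restrict_compl_singleton]
    _ = ∫ p, W p.1 * k p.2 ∂(sphVol n).prod
          (Measure.volumeIoiPow (Module.finrank ℝ 𝔼 - 1)) := by
        simp only [hpol]
        exact (volume : Measure 𝔼).measurePreserving_homeomorphUnitSphereProd.integral_comp
          (Homeomorph.measurableEmbedding _)
          (fun p : Sph n × Ioi (0 : ℝ) => W p.1 * k p.2)
    _ = _ := integral_prod_mul W fun r : Ioi (0 : ℝ) => k r

/-- Compactly supported continuous functions that vanish near the origin. -/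
structure IsCutoff (ψ : 𝔼 → ℝ) : Prop where
  cont : Continuous ψ
  compact : HasCompactSupport ψ
  zero : ψ =ᶠ[𝓝 0] 0

theorem IsCutoff.continuous_mul {ψ F : 𝔼 → ℝ} (hψ : IsCutoff ψ) (hF : ContinuousOn F {0}ᶜ) :
    Continuous (fun y => ψ y * F y) := by
  rw [continuous_iff_continuousAt]
  intro y
  by_cases hy : y = 0
  · subst hy
    refine (continuousAt_const (y := (0 : ℝ))).congr ?_
    filter_upwards [hψ.zero] with z hz
    rw [hz, Pi.zero_apply, zero_mul]
  · exact hψ.cont.continuousAt.mul (hF.continuousAt (isOpen_compl_singleton.mem_nhds hy))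

theorem IsCutoff.integrable_mul {ψ F : 𝔼 → ℝ} (hψ : IsCutoff ψ) (hF : ContinuousOn F {0}ᶜ) :
    Integrable (fun y => ψ y * F y) :=
  (hψ.continuous_mul hF).integrable_of_hasCompactSupport hψ.compact.mul_right

theorem IsCutoff.fderiv {ψ : 𝔼 → ℝ} (hψ : IsCutoff ψ) (hd : ContDiff ℝ ∞ ψ) (e : 𝔼) :
    IsCutoff (fun y => fderiv ℝ ψ y e) where
  cont := (hd.continuous_fderiv (by simp)).clm_apply continuous_const
  compact := hψ.compact.fderiv_apply ℝ e
  zero := by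
    filter_upwards [hψ.zero.fderiv (𝕜 := ℝ)] with z hz
    rw [hz]; simp

theorem IsCutoff.fderiv_mul {ψ F : 𝔼 → ℝ} (hψ : IsCutoff ψ) (hd : ContDiff ℝ ∞ ψ)
    (hF : ContDiffOn ℝ ∞ F {0}ᶜ) (y : 𝔼) :
    DifferentiableAt ℝ (fun y => ψ y * F y) y ∧ ∀ e, _root_.fderiv ℝ (fun y => ψ y * F y) y e
      = _root_.fderiv ℝ ψ y e * F y + ψ y * _root_.fderiv ℝ F y e := by
  by_cases hy : y = 0
  · subst hy
    have h1 : (fun y => ψ y * F y) =ᶠ[𝓝 0] fun _ => 0 := by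
      filter_upwards [hψ.zero] with z hz
      rw [hz, Pi.zero_apply, zero_mul]
    refine ⟨(differentiableAt_const (0 : ℝ)).congr_of_eventuallyEq h1, fun e => ?_⟩
    rw [h1.fderiv_eq, hψ.zero.fderiv_eq, hψ.zero.self_of_nhds]
    simp
  · have h1 : DifferentiableAt ℝ ψ y := hd.differentiable (by simp) y
    have h2 : DifferentiableAt ℝ F y :=
      (hF.contDiffAt (isOpen_compl_singleton.mem_nhds hy)).differentiableAt (by simp)
    refine ⟨h1.mul h2, fun e => ?_⟩
    rw [_root_.fderiv_fun_mul h1 h2]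
    simp; ring

/-- Green's first identity for a cutoff with radial gradient. -/
theorem integral_cutoff_laplacian {ψ : 𝔼 → ℝ} (hψ : IsCutoff ψ) (hd : ContDiff ℝ ∞ ψ)
    (hrad : ∀ y, ∃ m : ℝ, ∀ v, fderiv ℝ ψ y v = m * inner ℝ y v) {f g : Sph n → ℝ}
    (hf : ContDiffOn ℝ ∞ (ext f) {0}ᶜ) (hg : ContDiffOn ℝ ∞ (ext g) {0}ᶜ) :
    ∫ y : 𝔼, ψ y * (ext f y * Laplacian.laplacian (ext g) y) =
      -∑ i, ∫ y : 𝔼, ψ y * (fderiv ℝ (ext f) y (EuclideanSpace.basisFun (Fin (n + 1)) ℝ i)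
        * fderiv ℝ (ext g) y (EuclideanSpace.basisFun (Fin (n + 1)) ℝ i)) := by
  set e := EuclideanSpace.basisFun (Fin (n + 1)) ℝ with he
  have cf : ContinuousOn (ext f) {0}ᶜ := hf.continuousOn
  have cf1 := (contDiffOn_fderiv_ext hf).continuousOn
  have cg1 := (contDiffOn_fderiv_ext hg).continuousOn
  have cg2 := ((contDiffOn_fderiv_ext hg).fderiv_of_isOpen (m := ∞) isOpen_compl_singleton
      (by simp)).continuousOn
  have hsecond : ∀ i, ∀ y : 𝔼, y ≠ 0 → HasFDerivAt (fun z => fderiv ℝ (ext g) z (e i))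
      ((fderiv ℝ (fderiv ℝ (ext g)) y).flip (e i)) y := fun i y hy => by
    have := (differentiableAt_fderiv_ext hg hy).hasFDerivAt.clm_apply
      (hasFDerivAt_const (e i) y)
    refine this.congr_fderiv ?_
    ext v; simp
  have ibp : ∀ i, ∫ y : 𝔼, ψ y * (ext f y * fderiv ℝ (fderiv ℝ (ext g)) y (e i) (e i)) =
      -∫ y : 𝔼, (fderiv ℝ ψ y (e i) * (ext f y * fderiv ℝ (ext g) y (e i)) +
        ψ y * (fderiv ℝ (ext f) y (e i) * fderiv ℝ (ext g) y (e i))) := by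
    intro i
    have hsupp : ∀ y ∈ tsupport (fun y => ψ y * ext f y), y ≠ 0 := by
      rintro y hy rfl
      refine (notMem_tsupport_iff_eventuallyEq.2 ?_) hy
      filter_upwards [hψ.zero] with z hz
      simp [hz]
    have key := integral_mul_fderiv_eq_neg_fderiv_mul_of_integrable (μ := (volume : Measure 𝔼))
      (f := fun y => ψ y * ext f y) (g := fun y => fderiv ℝ (ext g) y (e i)) (v := e i)
      (by
        have : (fun y => fderiv ℝ (fun y => ψ y * ext f y) y (e i) * fderiv ℝ (ext g) y (e i)) =
            fun y => fderiv ℝ ψ y (e i) * (ext f y * fderiv ℝ (ext g) y (e i)) +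
              ψ y * (fderiv ℝ (ext f) y (e i) * fderiv ℝ (ext g) y (e i)) := by
          funext y; rw [(hψ.fderiv_mul hd hf y).2]; ring
        rw [this]
        exact ((hψ.fderiv hd (e i)).integrable_mul (by fun_prop)).add
          (hψ.integrable_mul (by fun_prop)))
      (by
        have : (fun y => ψ y * ext f y * fderiv ℝ (fun y => fderiv ℝ (ext g) y (e i)) y (e i)) =
            fun y => ψ y * (ext f y * fderiv ℝ (fderiv ℝ (ext g)) y (e i) (e i)) := by
          funext y
          by_cases hy : y = 0
          · rw [hy, hψ.zero.self_of_nhds]; simp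
          · rw [(hsecond i y hy).fderiv, mul_assoc]; simp
        rw [this]
        exact hψ.integrable_mul (by fun_prop))
      (by
        simp only [mul_assoc]
        exact hψ.integrable_mul (by fun_prop))
      (fun y _ => (hψ.fderiv_mul hd hf y).1)
      (fun y hy => (hsecond i y (hsupp y hy)).differentiableAt)
    refine (integral_congr_ae (Eventually.of_forall fun y => ?_)).trans (key.trans ?_)
    · by_cases hy : y = 0
      · simp only [hy, hψ.zero.self_of_nhds]; simp
      · simp only [(hsecond i y hy).fderiv, mul_assoc]; simp
    · congr 1
      refine integral_congr_ae (Eventually.of_forall fun y => ?_)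
      simp only [(hψ.fderiv_mul hd hf y).2]; ring
  -- The gradient of `ψ` is radial and that of `ext g` tangential, so their inner product vanishes
  -- pointwise.
  have hcross : ∑ i, ∫ y : 𝔼, fderiv ℝ ψ y (e i) * (ext f y * fderiv ℝ (ext g) y (e i)) = 0 := by
    rw [← integral_finsetSum _
      (fun i _ => (hψ.fderiv hd (e i)).integrable_mul (by fun_prop))]
    rw [← integral_zero 𝔼 ℝ]
    refine integral_congr_ae (Eventually.of_forall fun y => ?_)
    by_cases hy : y = 0
    · simp only [hy, hψ.zero.fderiv_eq]; simp
    · obtain ⟨m, hm⟩ := hrad y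
      have h1 : ∑ i, inner ℝ y (e i) * fderiv ℝ (ext g) y (e i) = 0 := by
        have h2 : fderiv ℝ (ext g) y (∑ i, inner ℝ (e i) y • e i) = 0 := by
          rw [e.sum_repr']; exact fderiv_ext_self hg hy
        rw [map_sum] at h2
        simpa only [map_smul, smul_eq_mul, real_inner_comm] using h2
      calc ∑ i, fderiv ℝ ψ y (e i) * (ext f y * fderiv ℝ (ext g) y (e i))
          = m * ext f y * ∑ i, inner ℝ y (e i) * fderiv ℝ (ext g) y (e i) := by
            rw [Finset.mul_sum]
            exact Finset.sum_congr rfl fun i _ => by rw [hm]; ring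
        _ = 0 := by rw [h1, mul_zero]
  simp only [laplacian_eq_sum, Finset.mul_sum]
  rw [integral_finsetSum _ (fun i _ => hψ.integrable_mul (by fun_prop))]
  rw [Finset.sum_congr rfl fun i _ => ibp i, Finset.sum_neg_distrib]
  rw [Finset.sum_congr rfl fun i _ => integral_add
    ((hψ.fderiv hd (e i)).integrable_mul (by fun_prop)) (hψ.integrable_mul (by fun_prop)),
    Finset.sum_add_distrib, hcross, zero_add]

/-- The Laplacian of the sphere is symmetric. -/
theorem integral_mul_sphLap_comm {f g : Sph n → ℝ}
    (hf : ContDiffOn ℝ ∞ (ext f) {0}ᶜ) (hg : ContDiffOn ℝ ∞ (ext g) {0}ᶜ) :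
    ∫ x, f x * sphLap g x ∂sphVol n = ∫ x, g x * sphLap f x ∂sphVol n := by
  -- A bump in `‖y‖²` gives a smooth radial cutoff supported in an annulus around the unit sphere.
  let b : ContDiffBump (1 : ℝ) := ⟨1 / 4, 1 / 2, by norm_num, by norm_num⟩
  let ψ : 𝔼 → ℝ := fun y => b (‖y‖ ^ 2)
  have hd : ContDiff ℝ ∞ ψ := b.contDiff.comp (contDiff_norm_sq ℝ)
  have hψ : IsCutoff ψ := by
    refine ⟨hd.continuous, ?_, ?_⟩
    · refine HasCompactSupport.intro (isCompact_closedBall (0 : 𝔼) 2) fun y hy => ?_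
      rw [mem_closedBall_zero_iff, not_le] at hy
      refine b.zero_of_le_dist ?_
      rw [Real.dist_eq]
      exact le_trans (by show (1 / 2 : ℝ) ≤ _; nlinarith) (le_abs_self _)
    · filter_upwards [Metric.ball_mem_nhds (0 : 𝔼) (show (0 : ℝ) < 1 / 2 by norm_num)] with y hy
      rw [mem_ball_zero_iff] at hy
      refine b.zero_of_le_dist ?_
      rw [Real.dist_eq, abs_sub_comm]
      exact le_trans (by show (1 / 2 : ℝ) ≤ _; nlinarith [norm_nonneg y]) (le_abs_self _)
  have hrad : ∀ y, ∃ m : ℝ, ∀ v, fderiv ℝ ψ y v = m * inner ℝ y v := by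
    intro y
    refine ⟨deriv b (‖y‖ ^ 2) * 2, fun v => ?_⟩
    have h1 : HasDerivAt b (deriv b (‖y‖ ^ 2)) (‖y‖ ^ 2) :=
      (b.contDiff (n := 1).differentiable (by simp) _).hasDerivAt
    have h2 := h1.comp_hasFDerivAt y (hasStrictFDerivAt_norm_sq y).hasFDerivAt
    have h3 : fderiv ℝ ψ y = _ := h2.fderiv
    rw [h3]
    simp [mul_assoc]
  -- The factor `r⁻¹ ^ 2` is the degree of homogeneity of the Laplacian of an extension.
  let k : ℝ → ℝ := fun r => b (r ^ 2) * r⁻¹ ^ 2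
  have hpolar : ∀ {f g : Sph n → ℝ}, ContDiffOn ℝ ∞ (ext g) {0}ᶜ →
      ∫ y : 𝔼, ψ y * (ext f y * Laplacian.laplacian (ext g) y) =
      (∫ x, f x * sphLap g x ∂sphVol n)
        * ∫ r : Ioi (0 : ℝ), k r ∂Measure.volumeIoiPow (Module.finrank ℝ 𝔼 - 1) := by
    intro f g hg
    rw [← integral_radial_mul_ext]
    refine integral_congr_ae (Eventually.of_forall fun y => ?_)
    by_cases hy : y = 0
    · simp only [hy, hψ.zero.self_of_nhds]; simp [k]
    · simp only [laplacian_ext hg hy, ext_eq _ hy, k, ψ]; ring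
  -- The polar formula with `W = 1` turns the radial factor into the integral of a nonnegative
  -- function that is positive at a point of the unit sphere, so the factor can be cancelled.
  have hpos : (∫ r : Ioi (0 : ℝ), k r ∂Measure.volumeIoiPow (Module.finrank ℝ 𝔼 - 1)) ≠ 0 := by
    have h1 := integral_radial_mul_ext k (fun _ : Sph n => (1 : ℝ))
    have h2 : 0 < ∫ y : 𝔼, k ‖y‖ * ext (fun _ : Sph n => (1 : ℝ)) y := by
      have h3 : ∀ y : 𝔼, k ‖y‖ * ext (fun _ : Sph n => (1 : ℝ)) y = ψ y * ‖y‖⁻¹ ^ 2 := by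
        intro y
        by_cases hy : y = 0
        · simp [k, hy]
        · simp [k, ψ, ext_eq _ hy]
      simp only [h3]
      have hc : ContinuousOn (fun y : 𝔼 => ‖y‖⁻¹ ^ 2) {0}ᶜ :=
        (continuous_norm.continuousOn.inv₀ fun y hy => norm_ne_zero_iff.2 hy).pow 2
      refine (hψ.continuous_mul hc).integral_pos_of_hasCompactSupport_nonneg_nonzero
        hψ.compact.mul_right (fun y => mul_nonneg b.nonneg (by positivity))
        (x := EuclideanSpace.single 0 1) ?_
      have : b 1 = 1 := b.eventuallyEq_one.self_of_nhds
      simp [ψ, this]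
    rw [h1] at h2
    exact (mul_ne_zero_iff.1 h2.ne').2
  refine mul_right_cancel₀ hpos ?_
  rw [← hpolar hg, ← hpolar hf, integral_cutoff_laplacian hψ hd hrad hf hg,
    integral_cutoff_laplacian hψ hd hrad hg hf]
  simp only [mul_comm]

end Symmetry

/-! ### Pairing functions on the sphere with a test function -/

section Pairing

variable {n : ℕ}

/-- The pairing `∫ f φ` over the sphere. -/
noncomputable def pairing (φ f : Sph n → ℝ) : ℝ := ∫ x, f x * φ x ∂sphVol n

theorem integrable_of_continuous {f : Sph n → ℝ} (hf : Continuous f) : Integrable f (sphVol n) :=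
  hf.integrable_of_hasCompactSupport (HasCompactSupport.of_compactSpace f)

theorem memLp_of_continuous {f : Sph n → ℝ} (hf : Continuous f) : MemLp f 2 (sphVol n) :=
  hf.memLp_of_hasCompactSupport (HasCompactSupport.of_compactSpace f)

theorem toL2_of_continuous {f : Sph n → ℝ} (hf : Continuous f) :
    toL2 f = (memLp_of_continuous hf).toLp f := dif_pos _

theorem inner_toL2 {f φ : Sph n → ℝ} (hf : Continuous f) (hφ : Continuous φ) :
    inner ℝ (toL2 f) (toL2 φ) = pairing φ f := by
  rw [toL2_of_continuous hf, toL2_of_continuous hφ, L2.inner_def, pairing]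
  refine integral_congr_ae ?_
  filter_upwards [(memLp_of_continuous hf).coeFn_toLp, (memLp_of_continuous hφ).coeFn_toLp]
    with x h1 h2
  rw [h1, h2]
  simp [mul_comm]

theorem toL2_add {f g : Sph n → ℝ} (hf : Continuous f) (hg : Continuous g) :
    toL2 (fun x => f x + g x) = toL2 f + toL2 g := by
  rw [toL2_of_continuous hf, toL2_of_continuous hg, toL2_of_continuous (f := fun x => f x + g x) (hf.add hg)]
  rfl

theorem toL2_const_mul {f : Sph n → ℝ} (c : ℝ) (hf : Continuous f) :
    toL2 (fun x => c * f x) = c • toL2 f := by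
  rw [toL2_of_continuous hf, toL2_of_continuous (f := fun x => c * f x) (continuous_const.mul hf)]
  rfl

theorem pairing_add {φ f g : Sph n → ℝ} (hφ : Continuous φ) (hf : Continuous f)
    (hg : Continuous g) : pairing φ (fun x => f x + g x) = pairing φ f + pairing φ g := by
  simp only [pairing, add_mul]
  exact integral_add (integrable_of_continuous (hf.mul hφ)) (integrable_of_continuous (hg.mul hφ))

theorem pairing_const_mul {φ f : Sph n → ℝ} (c : ℝ) :
    pairing φ (fun x => c * f x) = c * pairing φ f := by
  simp only [pairing, mul_assoc]
  exact integral_const_mul _ _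

theorem abs_pairing_sub_le {φ f g : Sph n → ℝ} (hφ : Continuous φ) (hf : Continuous f)
    (hg : Continuous g) {ε : ℝ} (h : ∀ x, |f x - g x| ≤ ε) :
    |pairing φ f - pairing φ g| ≤ ε * ∫ x, |φ x| ∂sphVol n := by
  have h1 : Integrable (fun x => f x * φ x) (sphVol n) := integrable_of_continuous (hf.mul hφ)
  have h2 : Integrable (fun x => g x * φ x) (sphVol n) := integrable_of_continuous (hg.mul hφ)
  rw [pairing, pairing, ← integral_sub h1 h2, ← integral_const_mul, ← Real.norm_eq_abs]
  refine norm_integral_le_of_norm_le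
    ((integrable_of_continuous hφ.abs).const_mul ε) (Eventually.of_forall fun x => ?_)
  rw [← sub_mul, Real.norm_eq_abs, abs_mul]
  exact mul_le_mul_of_nonneg_right (h x) (abs_nonneg _)

theorem ExtSmooth.continuous {u : ℝ → Sph n → ℝ} (hu : ExtSmooth u) {τ : ℝ} (hτ : 0 < τ) :
    Continuous (u τ) :=
  continuous_of_ext (hu.contDiffOn_ext hτ).continuousOn

theorem ExtSmooth.hasDerivAt_pairing {u : ℝ → Sph n → ℝ} (hu : ExtSmooth u) {φ : Sph n → ℝ}
    (hφ : Continuous φ) {τ : ℝ} (hτ : 0 < τ) :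
    HasDerivAt (fun t => pairing φ (u t)) (pairing φ (ModelSystem.dτ u τ)) τ := by
  -- Continuity on the compact set `[τ/2, 2τ] × S^n` supplies the constant dominating the
  -- `τ`-derivative of the integrand.
  have hcont : ContinuousOn (fun p : ℝ × Sph n => ModelSystem.dτ u p.1 p.2 * φ p.2)
      (Icc (τ / 2) (2 * τ) ×ˢ univ) :=
    (hu.dτ.continuousOn.mono (prod_mono (fun t ht => lt_of_lt_of_le (half_pos hτ) ht.1)
      subset_rfl)).mul (by fun_prop)
  obtain ⟨B, hB⟩ := (isCompact_Icc.prod isCompact_univ).exists_bound_of_continuousOn hcont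
  have hs : Icc (τ / 2) (2 * τ) ∈ 𝓝 τ := Icc_mem_nhds (by linarith) (by linarith)
  refine (hasDerivAt_integral_of_dominated_loc_of_deriv_le (bound := fun _ => B) hs ?_
    (integrable_of_continuous ((hu.continuous hτ).mul hφ))
    ((hu.dτ.continuous hτ).mul hφ).aestronglyMeasurable
    (Eventually.of_forall fun x t ht => hB (t, x) ⟨ht, mem_univ _⟩) (integrable_const _)
    (Eventually.of_forall fun x t ht => ?_)).2
  · filter_upwards [Ioi_mem_nhds hτ] with t ht
    exact ((hu.continuous ht).mul hφ).aestronglyMeasurable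
  · exact (hu.hasDerivAt (lt_of_lt_of_le (half_pos hτ) ht.1) x).mul_const (φ x)

end Pairing

/-! ### Eigenspaces, frequency projections and `log ∇` -/

section Eigen

variable {n : ℕ}

local notation "𝔼" => EuclideanSpace ℝ (Fin (n + 1))

theorem IsSmooth.continuous {f : Sph n → ℝ} (hf : IsSmooth f) : Continuous f :=
  ContMDiff.continuous hf

theorem sphLap_add {f g : Sph n → ℝ} (hf : IsSmooth f) (hg : IsSmooth g) (x : Sph n) :
    sphLap (fun x => f x + g x) x = sphLap f x + sphLap g x := by
  have hx := isOpen_compl_singleton.mem_nhds (sph_ne_zero x)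
  have h1 : ext (fun x => f x + g x) =ᶠ[𝓝 (x : 𝔼)] ext f + ext g := by
    filter_upwards [hx] with y hy
    simp only [Pi.add_apply, ext_eq _ hy]
  have h2 : ∀ {f : Sph n → ℝ}, IsSmooth f → ContDiffAt ℝ 2 (ext f) (x : 𝔼) := fun hf =>
    contDiffAt_infty.1 (hf.contDiffOn_ext.contDiffAt hx) 2
  rw [sphLap, (InnerProductSpace.laplacian_congr_nhds h1).self_of_nhds,
    (h2 hf).laplacian_add (h2 hg)]
  rfl

theorem sphLap_const_mul {f : Sph n → ℝ} (c : ℝ) (hf : IsSmooth f) (x : Sph n) :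
    sphLap (fun x => c * f x) x = c * sphLap f x := by
  have hx := isOpen_compl_singleton.mem_nhds (sph_ne_zero x)
  have h1 : ext (fun x => c * f x) =ᶠ[𝓝 (x : 𝔼)] c • ext f := by
    filter_upwards [hx] with y hy
    simp only [Pi.smul_apply, smul_eq_mul, ext_eq _ hy]
  have h2 : ContDiffAt ℝ 2 (ext f) (x : 𝔼) :=
    contDiffAt_infty.1 (hf.contDiffOn_ext.contDiffAt hx) 2
  rw [sphLap, (InnerProductSpace.laplacian_congr_nhds h1).self_of_nhds,
    InnerProductSpace.laplacian_smul c h2]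
  rfl

/-- The space of (classes of) smooth eigenfunctions of frequency `r`. -/
noncomputable def eigenspace (n : ℕ) (r : ℝ≥0) : Submodule ℝ (L2 n) where
  carrier := {u | ∃ φ : Sph n → ℝ, IsSmooth φ ∧ (∀ x, -sphLap φ x = (r : ℝ) ^ 2 * φ x) ∧
    u = toL2 φ}
  add_mem' := by
    rintro _ _ ⟨φ, hφ, h1, rfl⟩ ⟨ψ, hψ, h2, rfl⟩
    refine ⟨fun x => φ x + ψ x, ContMDiff.add hφ hψ, fun x => ?_,
      (toL2_add hφ.continuous hψ.continuous).symm⟩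
    rw [sphLap_add hφ hψ, neg_add, h1, h2, mul_add]
  zero_mem' := by
    -- Zero is written as a product so that the rules for constant multiples apply to it.
    refine ⟨fun _ => 0 * 0, contMDiff_const, fun x => ?_, ?_⟩
    · rw [sphLap_const_mul (f := fun _ => 0) 0 contMDiff_const]; simp
    · rw [toL2_const_mul (f := fun _ => 0) 0 continuous_const, zero_smul]
  smul_mem' := by
    rintro c _ ⟨φ, hφ, h1, rfl⟩
    refine ⟨fun x => c * φ x, ContMDiff.mul contMDiff_const hφ, fun x => ?_,
      (toL2_const_mul c hφ.continuous).symm⟩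
    rw [sphLap_const_mul c hφ, ← mul_neg, h1]; ring

theorem spectralSpace_eq (n : ℕ) (I : Set ℝ≥0) :
    spectralSpace n I = (⨆ r : I, eigenspace n r).topologicalClosure := by
  unfold spectralSpace
  congr 1
  rw [Submodule.iSup_eq_span]
  congr 1
  ext u
  simp only [mem_ofPred_eq, mem_iUnion, Subtype.exists]
  constructor
  · rintro ⟨φ, h1, ⟨r, hr, h2⟩, h3⟩
    exact ⟨r, hr, φ, h1, h2, h3⟩
  · rintro ⟨r, hr, φ, h1, h2, h3⟩
    exact ⟨φ, h1, ⟨r, hr, h2⟩, h3⟩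

theorem eigenspace_le_spectralSpace {I : Set ℝ≥0} {r : ℝ≥0} (hr : r ∈ I) :
    eigenspace n r ≤ spectralSpace n I := by
  rw [spectralSpace_eq]
  exact (le_iSup (fun r : I => eigenspace n r) ⟨r, hr⟩).trans (Submodule.le_topologicalClosure _)

/-- Integration by parts against an eigenfunction. -/
theorem pairing_sphLap {f φ : Sph n → ℝ} (hf : ContDiffOn ℝ ∞ (ext f) {0}ᶜ) (hφ : IsSmooth φ)
    {r : ℝ≥0} (h : ∀ x, -sphLap φ x = (r : ℝ) ^ 2 * φ x) :
    pairing φ (sphLap f) = -((r : ℝ) ^ 2 * pairing φ f) := by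
  have h1 := integral_mul_sphLap_comm hφ.contDiffOn_ext hf
  have h2 : ∀ x, sphLap φ x = -((r : ℝ) ^ 2 * φ x) := fun x => by rw [← h x, neg_neg]
  calc pairing φ (sphLap f) = ∫ x, φ x * sphLap f x ∂sphVol n := by
        simp only [pairing, mul_comm]
    _ = ∫ x, -((r : ℝ) ^ 2) * (f x * φ x) ∂sphVol n := by
        rw [h1]
        exact integral_congr_ae (Eventually.of_forall fun x => by simp only [h2]; ring)
    _ = _ := by rw [integral_const_mul, pairing]; ring

/-- Symmetry gives `(r² - s²) ⟨φ, ψ⟩ = 0`, and distinct nonnegative frequencies have distinct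
squares. -/
theorem eigenspace_orthogonal {r s : ℝ≥0} (hrs : r ≠ s) {u v : L2 n} (hu : u ∈ eigenspace n r)
    (hv : v ∈ eigenspace n s) : inner ℝ u v = 0 := by
  obtain ⟨φ, hφ, h1, rfl⟩ := hu
  obtain ⟨ψ, hψ, h2, rfl⟩ := hv
  rw [inner_toL2 hφ.continuous hψ.continuous]
  have e1 := pairing_sphLap hφ.contDiffOn_ext hψ h2
  have e2 : pairing ψ (sphLap φ) = -((r : ℝ) ^ 2 * pairing ψ φ) := by
    have : sphLap φ = fun x => -(r : ℝ) ^ 2 * φ x := by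
      funext x; rw [neg_mul, ← h1 x, neg_neg]
    rw [this, pairing_const_mul, neg_mul]
  have e3 : ((r : ℝ) ^ 2 - (s : ℝ) ^ 2) * pairing ψ φ = 0 := by linarith
  refine (mul_eq_zero.1 e3).resolve_left fun h => hrs ?_
  rw [sub_eq_zero, sq_eq_sq₀ r.coe_nonneg s.coe_nonneg] at h
  exact_mod_cast h

theorem orthogonalFamily_eigenspace (n : ℕ) :
    OrthogonalFamily ℝ (fun r => eigenspace n r) fun r => (eigenspace n r).subtypeₗᵢ := by
  intro r s hrs u v
  exact eigenspace_orthogonal hrs u.2 v.2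

theorem inner_freqProj {I : Set ℝ≥0} {r : ℝ≥0} (hr : r ∈ I) (f : L2 n) {v : L2 n}
    (hv : v ∈ eigenspace n r) : inner ℝ (freqProj I f) v = inner ℝ f v := by
  rw [freqProj, Submodule.inner_starProjection_left_eq_right,
    Submodule.starProjection_eq_self_iff.2 (eigenspace_le_spectralSpace hr hv)]

theorem inner_freqProj_of_notMem {I : Set ℝ≥0} {r : ℝ≥0} (hr : r ∉ I) (f : L2 n) {v : L2 n}
    (hv : v ∈ eigenspace n r) : inner ℝ (freqProj I f) v = 0 := by
  have h1 : v ∈ (spectralSpace n I)ᗮ := by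
    rw [spectralSpace_eq, Submodule.orthogonal_closure, ← Submodule.iInf_orthogonal,
      Submodule.mem_iInf]
    rintro ⟨s, hs⟩
    rw [Submodule.mem_orthogonal]
    exact fun u hu => eigenspace_orthogonal (fun h : s = r => hr (h ▸ hs)) hu hv
  exact h1 _ (Submodule.starProjection_apply_mem _ _)

/-- The bound passes to the closure by continuity; then it is applied to `v = freqProj I f`, for
which the inner product is `‖v‖²`. -/
theorem norm_freqProj_le {I : Set ℝ≥0} {f : L2 n} {B : ℝ} (hB : 0 ≤ B)
    (h : ∀ v ∈ ⨆ r : I, eigenspace n r, |inner ℝ f v| ≤ B * ‖v‖) : ‖freqProj I f‖ ≤ B := by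
  have h1 : ∀ v ∈ spectralSpace n I, |inner ℝ f v| ≤ B * ‖v‖ := by
    intro v hv
    rw [spectralSpace_eq] at hv
    have hcl : IsClosed {v : L2 n | |inner ℝ f v| ≤ B * ‖v‖} :=
      isClosed_le (by fun_prop) (by fun_prop)
    exact closure_minimal h hcl hv
  have hmem : freqProj I f ∈ spectralSpace n I := Submodule.starProjection_apply_mem _ _
  have h2 := h1 _ hmem
  have h3 : inner ℝ f (freqProj I f) = ‖freqProj I f‖ ^ 2 := by
    rw [← real_inner_self_eq_norm_sq]
    have h4 := Submodule.inner_starProjection_left_eq_right (spectralSpace n I) f (freqProj I f)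
    rw [Submodule.starProjection_eq_self_iff.2 hmem] at h4
    exact h4.symm
  rw [h3, abs_of_nonneg (sq_nonneg _), sq] at h2
  rcases (norm_nonneg (freqProj I f)).eq_or_lt with h0 | h0
  · rwa [← h0]
  · exact le_of_mul_le_mul_right h2 h0

theorem norm_freqProj_singleton_le {r : ℝ≥0} {f : L2 n} {B : ℝ} (hB : 0 ≤ B)
    (h : ∀ v ∈ eigenspace n r, |inner ℝ f v| ≤ B * ‖v‖) : ‖freqProj {r} f‖ ≤ B := by
  refine norm_freqProj_le hB fun v hv => h v ?_
  simpa using hv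

/-- Decay of the high frequency parts of a smooth function. -/
theorem norm_freqProj_toL2_le {F : Sph n → ℝ} (hF : IsSmooth F) {I : Set ℝ≥0} {R : ℝ}
    (hR : 0 < R) (hI : ∀ r ∈ I, R ≤ (r : ℝ)) :
    ‖freqProj I (toL2 F)‖ ≤ (R⁻¹) ^ 2 * ‖toL2 (sphLap F)‖ := by
  refine norm_freqProj_le (by positivity) fun v hv => ?_
  obtain ⟨g, hg, rfl⟩ := (Submodule.mem_iSup_iff_exists_finsupp _ _).1 hv
  have hpos : ∀ r : I, (0 : ℝ) < (r : ℝ≥0) := fun r => hR.trans_le (hI r r.2)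
  -- Dividing by the eigenvalue moves the Laplacian onto `F`; by orthogonality the rescaling by
  -- `r⁻²` shrinks a finite sum of eigenfunctions by at least `R⁻²`.
  have h1 : ∀ r : I, inner ℝ (toL2 F) (g r)
      = -inner ℝ (toL2 (sphLap F)) (((r : ℝ≥0) : ℝ)⁻¹ ^ 2 • g r) := by
    intro r
    obtain ⟨φ, hφ, h2, h3⟩ := hg r
    rw [inner_smul_right, h3, inner_toL2 hF.continuous hφ.continuous,
      inner_toL2 (continuous_sphLap hF.contDiffOn_ext) hφ.continuous,
      pairing_sphLap hF.contDiffOn_ext hφ h2]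
    have := (hpos r).ne'
    field_simp
  have hfam := (orthogonalFamily_eigenspace n).comp (Subtype.val_injective (p := (· ∈ I)))
  have h2 : ‖∑ r ∈ g.support, ((r : ℝ≥0) : ℝ)⁻¹ ^ 2 • g r‖
      ≤ R⁻¹ ^ 2 * ‖∑ r ∈ g.support, g r‖ := by
    have e1 := hfam.norm_sum (fun r : I => ⟨g r, hg r⟩) g.support
    have e2 := hfam.norm_sum (fun r : I => ((r : ℝ≥0) : ℝ)⁻¹ ^ 2 • ⟨g r, hg r⟩) g.support
    simp only [Submodule.coe_subtypeₗᵢ, Submodule.subtype_apply, Submodule.coe_smul,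
      Submodule.coe_norm] at e1 e2
    refine le_of_sq_le_sq ?_ (by positivity)
    rw [e2, mul_pow, e1, Finset.mul_sum]
    refine Finset.sum_le_sum fun r _ => ?_
    rw [norm_smul, mul_pow]
    gcongr
    rw [Real.norm_of_nonneg (by positivity)]
    gcongr
    exact hI r r.2
  have h3 : inner ℝ (toL2 F) (∑ r ∈ g.support, g r)
      = -inner ℝ (toL2 (sphLap F)) (∑ r ∈ g.support, ((r : ℝ≥0) : ℝ)⁻¹ ^ 2 • g r) := by
    rw [inner_sum, inner_sum, ← Finset.sum_neg_distrib]
    exact Finset.sum_congr rfl fun r _ => h1 r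
  change |inner ℝ (toL2 F) (∑ r ∈ g.support, g r)| ≤ _ * ‖∑ r ∈ g.support, g r‖
  rw [h3, abs_neg]
  calc _ ≤ ‖toL2 (sphLap F)‖ * ‖∑ r ∈ g.support, ((r : ℝ≥0) : ℝ)⁻¹ ^ 2 • g r‖ :=
        abs_real_inner_le_norm _ _
    _ ≤ ‖toL2 (sphLap F)‖ * (R⁻¹ ^ 2 * ‖∑ r ∈ g.support, g r‖) := by gcongr
    _ = _ := by ring

/-- The frequencies of the Littlewood-Paley piece of index `l`. -/
def lpSet : ℕ → Set ℝ≥0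
  | 0 => Iic 1
  | l + 1 => Ioc (2 ^ l) (2 ^ (l + 1))

theorem lpPiece_eq (f : L2 n) (l : ℕ) : lpPiece f l = freqProj (lpSet l) f := by
  cases l <;> rfl

theorem le_two_pow_of_mem_lpSet {r : ℝ≥0} {l : ℕ} (h : r ∈ lpSet l) : r ≤ 2 ^ l := by
  cases l with
  | zero => simpa [lpSet] using h
  | succ l => exact h.2

theorem notMem_lpSet {r : ℝ≥0} {l m : ℕ} (h : r ∈ lpSet l) (hlm : m ≠ l) : r ∉ lpSet m := by
  wlog hlt : l < m generalizing l m
  · exact fun hm => this hm hlm.symm (by omega) h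
  obtain ⟨k, rfl⟩ := Nat.exists_eq_succ_of_ne_zero (by omega : m ≠ 0)
  intro hm
  have h1 : (2 : ℝ≥0) ^ l ≤ 2 ^ k := pow_le_pow_right₀ one_le_two (by omega)
  exact absurd (hm.1.trans_le ((le_two_pow_of_mem_lpSet h).trans h1)) (lt_irrefl _)

theorem exists_mem_lpSet (r : ℝ≥0) : ∃ l, r ∈ lpSet l := by
  have hex : ∃ l : ℕ, r ≤ 2 ^ l := by
    obtain ⟨l, hl⟩ := pow_unbounded_of_one_lt r (one_lt_two (α := ℝ≥0))
    exact ⟨l, hl.le⟩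
  classical
  refine ⟨Nat.find hex, ?_⟩
  have h1 := Nat.find_spec hex
  cases hl : Nat.find hex with
  | zero => rw [hl] at h1; simpa [lpSet] using h1
  | succ k =>
    rw [hl] at h1
    exact ⟨not_le.1 (Nat.find_min hex (m := k) (by omega)), h1⟩

/-- On the dyadic block `Λ` and `2 ^ l` agree up to a factor `2`, and `log 2 ≤ 1`. This also covers
the block `l = 0`. -/
theorem abs_log_sub_le {r : ℝ≥0} {l : ℕ} (h : r ∈ lpSet l) {Λ : ℝ} (hΛ : 1 ≤ Λ)
    (hΛr : Λ ^ 2 = 1 + (r : ℝ) ^ 2) : |l * Real.log 2 - Real.log Λ| ≤ 1 := by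
  have hlog2 : 0 < Real.log 2 := Real.log_pos one_lt_two
  have hlog2' : Real.log 2 ≤ 1 := by
    have := Real.log_le_sub_one_of_pos (show (0 : ℝ) < 2 by norm_num); linarith
  have hΛ0 : 0 < Λ := by linarith
  have hupper : Λ ≤ 2 * 2 ^ l := by
    have h1 : (r : ℝ) ≤ 2 ^ l := by exact_mod_cast le_two_pow_of_mem_lpSet h
    have h2 : (1 : ℝ) ≤ 2 ^ l := one_le_pow₀ one_le_two
    nlinarith [r.2]
  have hlower : 2 ^ l ≤ 2 * Λ := by
    cases l with
    | zero => norm_num; linarith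
    | succ k =>
      have h1 : (2 : ℝ) ^ k < r := by exact_mod_cast h.1
      have h2 : (r : ℝ) ≤ Λ := by nlinarith [r.2]
      rw [pow_succ]; linarith
  have e1 := Real.log_le_log hΛ0 hupper
  have e2 := Real.log_le_log (by positivity) hlower
  rw [Real.log_mul two_ne_zero (by positivity), Real.log_pow] at e1
  rw [Real.log_mul two_ne_zero hΛ0.ne', Real.log_pow] at e2
  rw [abs_le]
  constructor <;> linarith

/-- The pieces of a smooth function decay like `4 ^ (-l)`, which beats the factor `l`. Without
summability the `tsum` defining `logNabla` would be a default value. -/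
theorem summable_logNabla {F : Sph n → ℝ} (hF : IsSmooth F) :
    Summable fun l : ℕ => ((l : ℝ) * Real.log 2) • lpPiece (toL2 F) l := by
  have hlog2 : 0 < Real.log 2 := Real.log_pos one_lt_two
  rw [← summable_nat_add_iff 1]
  refine Summable.of_norm_bounded (g := fun l : ℕ =>
    (((l : ℝ) + 1) ^ 1 * (1 / 4) ^ l) * (Real.log 2 * ‖toL2 (sphLap F)‖)) ?_ fun l => ?_
  · have h1 : Summable fun l : ℕ => ((l : ℝ) ^ 1 * (1 / 4 : ℝ) ^ l) :=
      summable_pow_mul_geometric_of_norm_lt_one 1 (by norm_num)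
    have h2 : Summable fun l : ℕ => (1 / 4 : ℝ) ^ l :=
      summable_geometric_of_lt_one (by norm_num) (by norm_num)
    refine Summable.mul_right _ ((h1.add h2).congr fun l => by ring)
  · rw [norm_smul, Real.norm_of_nonneg (by positivity), lpPiece_eq]
    have h1 := norm_freqProj_toL2_le hF (I := lpSet (l + 1)) (R := 2 ^ l) (by positivity)
      (fun r hr => by exact_mod_cast hr.1.le)
    have h2 : ((2 : ℝ) ^ l)⁻¹ ^ 2 = (1 / 4) ^ l := by
      rw [← inv_pow, ← pow_mul, mul_comm, pow_mul]; norm_num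
    rw [h2] at h1
    calc _ ≤ (((l + 1 : ℕ) : ℝ) * Real.log 2) * ((1 / 4) ^ l * ‖toL2 (sphLap F)‖) := by gcongr
      _ = _ := by push_cast; ring

theorem inner_logNabla {F : Sph n → ℝ} (hF : IsSmooth F) {r : ℝ≥0} {l : ℕ} (hl : r ∈ lpSet l)
    {v : L2 n} (hv : v ∈ eigenspace n r) :
    inner ℝ (logNabla (toL2 F)) v = l * Real.log 2 * inner ℝ (toL2 F) v := by
  have h1 := (innerSL ℝ v).map_tsum (summable_logNabla hF)
  simp only [innerSL_apply_apply] at h1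
  rw [real_inner_comm, logNabla, h1, tsum_eq_single l]
  · rw [inner_smul_right, real_inner_comm, lpPiece_eq, inner_freqProj hl _ hv]
  · intro m hm
    rw [inner_smul_right, real_inner_comm, lpPiece_eq,
      inner_freqProj_of_notMem (notMem_lpSet hl hm) _ hv, mul_zero]

end Eigen

/-! ### From solutions to modes, and summation over frequencies -/

section Solution

variable {n : ℕ}

theorem DerivBound.abs_le {f : Sph n → ℝ} {c : ℝ} (h : DerivBound 0 f c) (x : Sph n) :
    |f x| ≤ c := by
  simpa using h x

theorem SmoothBigO.abs_le {u : ℝ → Sph n → ℝ} {g : ℝ → ℝ} (h : SmoothBigO u g) :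
    ∃ c : ℝ, ∀ᶠ τ in 𝓝[>] (0 : ℝ), ∀ x, |u τ x| ≤ c * g τ := by
  obtain ⟨c, hc⟩ := h 0
  exact ⟨c, hc.mono fun τ hτ => hτ.abs_le⟩

/-- The cube arises when the `O(τ² |log τ|²)` error of `τ ∂_τ α` is multiplied by `log τ`. -/
theorem tendsto_mul_abs_log_pow :
    Tendsto (fun τ : ℝ => τ ^ 2 * |Real.log τ| ^ 2) (𝓝[>] 0) (𝓝 0) ∧
    Tendsto (fun τ : ℝ => τ ^ 2 * |Real.log τ| ^ 3) (𝓝[>] 0) (𝓝 0) := by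
  constructor
  · have h := ((tendsto_log_mul_rpow_nhdsGT_zero (r := 1) one_pos).abs).pow 2
    simp only [abs_zero, zero_pow two_ne_zero] at h
    refine h.congr' ?_
    filter_upwards [self_mem_nhdsWithin] with τ hτ
    rw [Real.rpow_one, abs_mul, mul_pow, sq_abs τ, mul_comm]
  · have h := ((tendsto_log_mul_rpow_nhdsGT_zero (r := 2 / 3) (by norm_num)).abs).pow 3
    simp only [abs_zero, zero_pow three_ne_zero] at h
    refine h.congr' ?_
    filter_upwards [self_mem_nhdsWithin] with τ hτ
    have hτ0 : (0 : ℝ) < τ := hτ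
    have h1 : (τ ^ (2 / 3 : ℝ)) ^ 3 = τ ^ 2 := by
      rw [← Real.rpow_natCast, ← Real.rpow_mul hτ0.le]
      norm_num
    rw [abs_mul, mul_pow, abs_of_pos (Real.rpow_pos_of_pos hτ0 _), h1, mul_comm]

variable {q : ℝ} {f₁ f₂ f₃ : ℝ → ℝ} {χ₀ O h : Sph n → ℝ} {α χ : ℝ → Sph n → ℝ}

section Mode

variable (hS : IsSmoothSolution q f₁ f₂ f₃ χ₀ O h α χ) {φ : Sph n → ℝ} (hφ : IsSmooth φ)
include hS hφ

theorem IsSmoothSolution.isModeSolution {r : ℝ≥0}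
    (hr : ∀ x, -sphLap φ x = (r : ℝ) ^ 2 * φ x) :
    IsModeSolution q r f₁ f₂ f₃ (fun τ => pairing φ (α τ)) (fun τ => pairing φ (dτ α τ))
      (fun τ => pairing φ (dτ (dτ α) τ)) (fun τ => pairing φ (χ τ)) where
  deriv_a τ hτ := hS.smooth_α.extSmooth.hasDerivAt_pairing hφ.continuous hτ
  deriv_b τ hτ := hS.smooth_α.extSmooth.dτ.hasDerivAt_pairing hφ.continuous hτ
  deriv_c τ hτ := by
    have h1 := hS.smooth_χ.extSmooth.hasDerivAt_pairing hφ.continuous hτ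
    rwa [show dτ χ τ = fun x => 2 * τ * α τ x from funext (hS.eq_χ τ hτ), pairing_const_mul] at h1
  eq τ hτ := by
    have hα := hS.smooth_α.extSmooth
    have c1 : Continuous (dτ α τ) := hα.dτ.continuous hτ
    have c2 : Continuous (α τ) := hα.continuous hτ
    have c3 : Continuous (sphLap (α τ)) := continuous_sphLap (hα.contDiffOn_ext hτ)
    have c4 : Continuous (χ τ) := hS.smooth_χ.extSmooth.continuous hτ
    have h1 : dτ (dτ α) τ = fun x => (-(1 / τ) + f₁ τ * τ) * dτ α τ x +
        ((-(4 * q) + f₂ τ * τ ^ 2) * α τ x + (4 / (τ ^ 2 + 1) ^ 2 * sphLap (α τ) x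
          + f₃ τ * χ τ x)) := by
      funext x
      linarith [hS.eq_α τ hτ x]
    have hp := hφ.continuous
    rw [h1, pairing_add hp (by fun_prop) (by fun_prop), pairing_add hp (by fun_prop) (by fun_prop),
      pairing_add hp (by fun_prop) (by fun_prop), pairing_const_mul, pairing_const_mul,
      pairing_const_mul, pairing_const_mul, pairing_sphLap (hα.contDiffOn_ext hτ) hφ hr, modeWeight]
    ring

theorem IsSmoothSolution.exists_expansion_pairing : ∃ M : ℝ, ∀ᶠ τ in 𝓝[>] (0 : ℝ),
    |pairing φ (α τ) - (pairing φ O * Real.log τ + pairing φ h)|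
        ≤ M * (τ ^ 2 * |Real.log τ| ^ 2) ∧
    |τ * pairing φ (dτ α τ) - pairing φ O| ≤ M * (τ ^ 2 * |Real.log τ| ^ 2) := by
  obtain ⟨c, hc⟩ := hS.expansion_α.abs_le
  obtain ⟨d, hd⟩ := hS.expansion_dα.abs_le
  set m := ∫ x, |φ x| ∂sphVol n
  have hm : 0 ≤ m := integral_nonneg fun x => abs_nonneg _
  have cO := hS.smooth_data.2.1.continuous
  have ch := hS.smooth_data.2.2.continuous
  have hp := hφ.continuous
  refine ⟨max c d * m, ?_⟩
  filter_upwards [hc, hd, self_mem_nhdsWithin] with τ h1 h2 hτ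
  have hτ0 : (0 : ℝ) < τ := hτ
  have cα := hS.smooth_α.extSmooth.continuous hτ0
  have cα' := hS.smooth_α.extSmooth.dτ.continuous hτ0
  have hg : 0 ≤ τ ^ 2 * |Real.log τ| ^ 2 := by positivity
  constructor
  · have e1 : pairing φ O * Real.log τ + pairing φ h
        = pairing φ (fun x => Real.log τ * O x + h x) := by
      rw [pairing_add hp (by fun_prop) ch, pairing_const_mul, mul_comm]
    rw [e1]
    refine (abs_pairing_sub_le hp cα (by fun_prop)
      (ε := max c d * (τ ^ 2 * |Real.log τ| ^ 2)) fun x => ?_).trans_eq (by ring)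
    rw [show α τ x - (Real.log τ * O x + h x) = α τ x - O x * Real.log τ - h x by ring]
    exact (h1 x).trans (mul_le_mul_of_nonneg_right (le_max_left _ _) hg)
  · rw [← pairing_const_mul]
    refine (abs_pairing_sub_le hp (by fun_prop) cO
      (ε := max c d * (τ ^ 2 * |Real.log τ| ^ 2)) fun x => ?_).trans_eq (by ring)
    rw [show τ * dτ α τ x - O x = τ * (dτ α τ x - O x / τ) by field_simp, abs_mul,
      abs_of_pos hτ0]
    calc τ * |dτ α τ x - O x / τ| ≤ τ * (d * (τ * |Real.log τ| ^ 2)) :=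
          mul_le_mul_of_nonneg_left (h2 x) hτ0.le
      _ = d * (τ ^ 2 * |Real.log τ| ^ 2) := by ring
      _ ≤ _ := mul_le_mul_of_nonneg_right (le_max_right _ _) hg

theorem IsSmoothSolution.tendsto_mul_pairing_dτ :
    Tendsto (fun τ => τ * pairing φ (dτ α τ)) (𝓝[>] 0) (𝓝 (pairing φ O)) := by
  obtain ⟨M, hM⟩ := hS.exists_expansion_pairing hφ
  rw [tendsto_iff_norm_sub_tendsto_zero]
  refine squeeze_zero' (Eventually.of_forall fun τ => norm_nonneg _) (hM.mono fun τ hτ => hτ.2) ?_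
  simpa using tendsto_mul_abs_log_pow.1.const_mul M

/-- Writing `log (Λ τ) = log Λ + log τ`, the divergent terms `⟨O, φ⟩ log τ` cancel; the error terms
are small enough to survive multiplication by `log τ`. -/
theorem IsSmoothSolution.tendsto_pairing_sub {Λ : ℝ} (hΛ : 0 < Λ) :
    Tendsto (fun τ => pairing φ (α τ) - τ * pairing φ (dτ α τ) * Real.log (Λ * τ)) (𝓝[>] 0)
      (𝓝 (pairing φ h - pairing φ O * Real.log Λ)) := by
  obtain ⟨M, hM⟩ := hS.exists_expansion_pairing hφ
  have t1 : Tendsto (fun τ => pairing φ (α τ) - (pairing φ O * Real.log τ + pairing φ h))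
      (𝓝[>] 0) (𝓝 0) := by
    refine squeeze_zero_norm' (hM.mono fun τ hτ => hτ.1) ?_
    simpa using tendsto_mul_abs_log_pow.1.const_mul M
  have t2 : Tendsto (fun τ => (τ * pairing φ (dτ α τ) - pairing φ O) * Real.log τ)
      (𝓝[>] 0) (𝓝 0) := by
    refine squeeze_zero_norm' (hM.mono fun τ hτ => ?_)
      (by simpa using tendsto_mul_abs_log_pow.2.const_mul M)
    rw [norm_mul, Real.norm_eq_abs, Real.norm_eq_abs]
    calc _ ≤ M * (τ ^ 2 * |Real.log τ| ^ 2) * |Real.log τ| :=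
          mul_le_mul_of_nonneg_right hτ.2 (abs_nonneg _)
      _ = _ := by ring
  have t3 := (hS.tendsto_mul_pairing_dτ hφ).mul_const (Real.log Λ)
  have t4 := ((t1.add_const (pairing φ h)).sub t2).sub t3
  rw [zero_add, sub_zero] at t4
  refine t4.congr' ?_
  filter_upwards [self_mem_nhdsWithin] with τ hτ
  rw [Real.log_mul hΛ.ne' (ne_of_gt hτ)]
  ring

theorem IsSmoothSolution.tendsto_pairing_χ :
    Tendsto (fun τ => pairing φ (χ τ)) (𝓝[>] 0) (𝓝 (pairing φ χ₀)) := by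
  obtain ⟨hsm, u', hu', -, hder⟩ := hS.reg_χ
  obtain ⟨B, hB⟩ := isCompact_univ.exists_bound_of_continuousOn (hu' 0 le_rfl).continuous.continuousOn
  -- Order `0` and `ε = 1` suffice: a bounded difference quotient gives `χ(τ) - χ(0) = O(τ)`
  -- uniformly on the sphere.
  have h1 := hder 0 le_rfl 0 1 one_pos
  have hset : Ici (0 : ℝ) \ {0} = Ioi 0 := by
    ext t; simp only [Set.mem_sdiff, mem_Ici, mem_singleton_iff, mem_Ioi]
    exact ⟨fun h => lt_of_le_of_ne h.1 (Ne.symm h.2), fun h => ⟨h.le, h.ne'⟩⟩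
  rw [hset] at h1
  rw [tendsto_iff_norm_sub_tendsto_zero]
  refine squeeze_zero' (Eventually.of_forall fun τ => norm_nonneg _)
    (g := fun τ => τ * (1 + B) * ∫ x, |φ x| ∂sphVol n) ?_ ?_
  · filter_upwards [h1, self_mem_nhdsWithin] with τ h2 hτ
    have hτ0 : (0 : ℝ) < τ := hτ
    rw [Real.norm_eq_abs, ← hS.init_χ]
    refine abs_pairing_sub_le hφ.continuous (hsm τ hτ0.le).continuous
      (hsm 0 le_rfl).continuous fun x => ?_
    have h3 := h2.abs_le x
    have h4 : |u' 0 x| ≤ B := hB x (mem_univ x)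
    rw [sub_zero] at h3
    have h5 : |τ⁻¹ * (χ τ x - χ 0 x)| ≤ 1 + B := by
      calc _ = |(τ⁻¹ * (χ τ x - χ 0 x) - u' 0 x) + u' 0 x| := by rw [sub_add_cancel]
        _ ≤ _ := (abs_add_le _ _).trans (add_le_add h3 h4)
    rw [abs_mul, abs_of_pos (inv_pos.2 hτ0), inv_mul_le_iff₀ hτ0] at h5
    exact h5
  · have : Tendsto (fun τ : ℝ => τ * (1 + B) * ∫ x, |φ x| ∂sphVol n) (𝓝 0) (𝓝 0) := by
      have h : Continuous (fun τ : ℝ => τ * (1 + B) * ∫ x, |φ x| ∂sphVol n) := by fun_prop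
      simpa using h.tendsto 0
    exact this.mono_left nhdsWithin_le_nhds

end Mode

theorem sq_norm_freqProj_le {r : ℝ≥0} {f : L2 n} {D : ℝ} (hD : 0 ≤ D)
    (h : ∀ v ∈ eigenspace n r, (inner ℝ f v) ^ 2 ≤ D * ‖v‖ ^ 2) : ‖freqProj {r} f‖ ^ 2 ≤ D := by
  have h1 : ‖freqProj {r} f‖ ≤ √D := norm_freqProj_singleton_le (Real.sqrt_nonneg _) fun v hv => by
    rw [← Real.sqrt_sq (norm_nonneg v), ← Real.sqrt_mul hD]
    exact Real.abs_le_sqrt (h v hv)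
  calc _ ≤ √D ^ 2 := by gcongr
    _ = D := Real.sq_sqrt hD

theorem sq_inner_le {r : ℝ≥0} (f : L2 n) {v : L2 n} (hv : v ∈ eigenspace n r) :
    (inner ℝ f v) ^ 2 ≤ ‖freqProj {r} f‖ ^ 2 * ‖v‖ ^ 2 := by
  rw [← inner_freqProj (mem_singleton r) f hv, ← mul_pow, ← sq_abs]
  gcongr
  exact abs_real_inner_le_norm _ _

/-- The estimate for the projections of a solution to a single eigenspace. -/
theorem eigenspace_estimate (n : ℕ) {q : ℝ} (hq : 1 ≤ q) {K : ℝ} (hK : 0 ≤ K) :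
    ∃ C : ℝ, 0 ≤ C ∧ ∀ f₁ f₂ f₃ : ℝ → ℝ,
      (∀ τ ∈ Ioc (0 : ℝ) 1, |f₁ τ| ≤ K ∧ |f₂ τ| ≤ K ∧ |f₃ τ| ≤ K) →
      ∀ (χ₀ O h : Sph n → ℝ) (α χ : ℝ → Sph n → ℝ), IsSmoothSolution q f₁ f₂ f₃ χ₀ O h α χ →
      ∀ (r : ℝ≥0) (Λ κ : ℝ), 1 ≤ Λ → Λ ^ 2 = 1 + (r : ℝ) ^ 2 → Λ⁻¹ ≤ κ → κ ≤ Λ →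
      ∃ D : ℝ, D = C * (‖freqProj {r} (toL2 h - logNabla (toL2 O))‖ ^ 2
          + ‖freqProj {r} (toL2 O)‖ ^ 2 + κ * ‖freqProj {r} (toL2 χ₀)‖ ^ 2) ∧
        Λ * ‖freqProj {r} (toL2 (α 1))‖ ^ 2 ≤ D ∧
        Λ⁻¹ * ‖freqProj {r} (toL2 (dτ α 1))‖ ^ 2 ≤ D ∧
        κ * ‖freqProj {r} (toL2 (χ 1))‖ ^ 2 ≤ D := by
  obtain ⟨C, hC, hmode⟩ := mode_estimate hq hK
  -- The limit of `r` is `⟨𝔥, v⟩` plus at most `|o|`, so its square costs `2 ⟨𝔥, v⟩² + 2 o²`; the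
  -- limit of `p` adds one more `o²`.
  refine ⟨3 * C, by positivity, ?_⟩
  intro f₁ f₂ f₃ hf χ₀ O h α χ hS r Λ κ hΛ hΛr hκ hκ'
  refine ⟨_, rfl, ?_⟩
  have hΛ0 : 0 < Λ := by linarith
  have hκ0 : 0 < κ := (inv_pos.2 hΛ0).trans_le hκ
  set 𝔥 := toL2 h - logNabla (toL2 O) with h𝔥
  set D := 3 * C * (‖freqProj {r} 𝔥‖ ^ 2 + ‖freqProj {r} (toL2 O)‖ ^ 2
    + κ * ‖freqProj {r} (toL2 χ₀)‖ ^ 2) with hD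
  have hD0 : 0 ≤ D := by positivity
  have cα := hS.smooth_α.extSmooth.continuous one_pos
  have cα' := hS.smooth_α.extSmooth.dτ.continuous one_pos
  have cχ := hS.smooth_χ.extSmooth.continuous one_pos
  have key : ∀ v ∈ eigenspace n r, Λ * inner ℝ (toL2 (α 1)) v ^ 2
      + Λ⁻¹ * inner ℝ (toL2 (dτ α 1)) v ^ 2 + κ * inner ℝ (toL2 (χ 1)) v ^ 2 ≤ D * ‖v‖ ^ 2 := by
    intro v hv
    have i1 := sq_inner_le 𝔥 hv
    have i2 := sq_inner_le (toL2 O) hv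
    have i3 := sq_inner_le (toL2 χ₀) hv
    obtain ⟨l, hl⟩ := exists_mem_lpSet r
    have i4 : inner ℝ 𝔥 v = inner ℝ (toL2 h) v - l * Real.log 2 * inner ℝ (toL2 O) v := by
      rw [h𝔥, inner_sub_left, inner_logNabla hS.smooth_data.2.1 hl hv]
    obtain ⟨φ, hφ, hr, hvφ⟩ := hv
    have hp := hφ.continuous
    have est := hmode r Λ κ f₁ f₂ f₃ _ _ _ _ (hS.isModeSolution hφ hr) hf hΛ hΛr hκ hκ' _ _ _
      (hS.tendsto_mul_pairing_dτ hφ) (hS.tendsto_pairing_sub hφ hΛ0) (hS.tendsto_pairing_χ hφ)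
    rw [← inner_toL2 cα hp, ← inner_toL2 cα' hp, ← inner_toL2 cχ hp,
      ← inner_toL2 hS.smooth_data.1.continuous hp, ← inner_toL2 hS.smooth_data.2.1.continuous hp,
      ← inner_toL2 hS.smooth_data.2.2.continuous hp, ← hvφ] at est
    refine est.trans ?_
    set o := inner ℝ (toL2 O) v
    have i5 : inner ℝ (toL2 h) v - o * Real.log Λ
        = inner ℝ 𝔥 v + (l * Real.log 2 - Real.log Λ) * o := by rw [i4]; ring
    have i6 : ((l * Real.log 2 - Real.log Λ) * o) ^ 2 ≤ o ^ 2 := by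
      rw [mul_pow]
      refine mul_le_of_le_one_left (sq_nonneg _) ?_
      rw [sq_le_one_iff_abs_le_one]
      exact abs_log_sub_le hl hΛ hΛr
    have i7 : (inner ℝ (toL2 h) v - o * Real.log Λ) ^ 2 ≤ 2 * inner ℝ 𝔥 v ^ 2 + 2 * o ^ 2 := by
      rw [i5]
      refine add_sq_le.trans ?_
      linarith
    have i8 := mul_le_mul_of_nonneg_left i3 hκ0.le
    have i9 : 0 ≤ κ * inner ℝ (toL2 χ₀) v ^ 2 := by positivity
    calc _ ≤ C * (3 * (‖freqProj {r} 𝔥‖ ^ 2 * ‖v‖ ^ 2 + ‖freqProj {r} (toL2 O)‖ ^ 2 * ‖v‖ ^ 2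
          + κ * (‖freqProj {r} (toL2 χ₀)‖ ^ 2 * ‖v‖ ^ 2))) := by
          gcongr
          linarith [sq_nonneg (inner ℝ 𝔥 v)]
      _ = D * ‖v‖ ^ 2 := by rw [hD]; ring
  have red : ∀ (f : L2 n) (μ : ℝ), 0 < μ →
      (∀ v ∈ eigenspace n r, μ * inner ℝ f v ^ 2 ≤ D * ‖v‖ ^ 2) →
      μ * ‖freqProj {r} f‖ ^ 2 ≤ D := by
    intro f μ hμ hv
    rw [← le_div_iff₀' hμ]
    refine sq_norm_freqProj_le (by positivity) fun v hv' => ?_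
    rw [div_mul_eq_mul_div, le_div_iff₀' hμ]
    exact hv v hv'
  refine ⟨red _ _ hΛ0 fun v hv => ?_, red _ _ (inv_pos.2 hΛ0) fun v hv => ?_,
    red _ _ hκ0 fun v hv => ?_⟩ <;>
  · have h1 := key v hv
    have h2 : 0 ≤ Λ * inner ℝ (toL2 (α 1)) v ^ 2 := by positivity
    have h3 : 0 ≤ Λ⁻¹ * inner ℝ (toL2 (dτ α 1)) v ^ 2 := by positivity
    have h4 : 0 ≤ κ * inner ℝ (toL2 (χ 1)) v ^ 2 := by positivity
    linarith

/-- Summation of the estimates for the single frequencies. -/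
theorem sobNorm_le_of_forall {C s t t₃ : ℝ} (hC : 0 ≤ C) {f g₁ g₂ g₃ : L2 n}
    (h : ∀ r : ℝ≥0, (1 + (r : ℝ) ^ 2) ^ t * ‖freqProj {r} f‖ ^ 2 ≤
      C * ((1 + (r : ℝ) ^ 2) ^ s * ‖freqProj {r} g₁‖ ^ 2
        + (1 + (r : ℝ) ^ 2) ^ s * ‖freqProj {r} g₂‖ ^ 2
        + (1 + (r : ℝ) ^ 2) ^ t₃ * ‖freqProj {r} g₃‖ ^ 2)) :
    sobNorm t f ≤ (√C).toNNReal * (sobNorm s g₁ + sobNorm s g₂ + sobNorm t₃ g₃) := by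
  have hterm : ∀ (t : ℝ) (f : L2 n) (r : ℝ≥0), ENNReal.ofReal ((1 + (r : ℝ) ^ 2) ^ t)
      * ‖freqProj {r} f‖ₑ ^ 2
      = ENNReal.ofReal ((1 + (r : ℝ) ^ 2) ^ t * ‖freqProj {r} f‖ ^ 2) := by
    intro t f r
    rw [ENNReal.ofReal_mul (by positivity), ENNReal.ofReal_pow (norm_nonneg _), ofReal_norm]
  have hsum : ∑' r : ℝ≥0, ENNReal.ofReal ((1 + (r : ℝ) ^ 2) ^ t) * ‖freqProj {r} f‖ₑ ^ 2 ≤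
      ENNReal.ofReal C *
        (∑' r : ℝ≥0, ENNReal.ofReal ((1 + (r : ℝ) ^ 2) ^ s) * ‖freqProj {r} g₁‖ₑ ^ 2
        + ∑' r : ℝ≥0, ENNReal.ofReal ((1 + (r : ℝ) ^ 2) ^ s) * ‖freqProj {r} g₂‖ₑ ^ 2
        + ∑' r : ℝ≥0, ENNReal.ofReal ((1 + (r : ℝ) ^ 2) ^ t₃) * ‖freqProj {r} g₃‖ₑ ^ 2) := by
    rw [← ENNReal.tsum_add, ← ENNReal.tsum_add, ← ENNReal.tsum_mul_left]
    refine ENNReal.tsum_le_tsum fun r => ?_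
    rw [hterm, hterm, hterm, hterm, ← ENNReal.ofReal_add (by positivity) (by positivity),
      ← ENNReal.ofReal_add (by positivity) (by positivity), ← ENNReal.ofReal_mul hC]
    exact ENNReal.ofReal_le_ofReal (h r)
  have hC2 : ENNReal.ofReal C ^ (1 / 2 : ℝ) = (√C).toNNReal := by
    rw [ENNReal.ofReal_rpow_of_nonneg hC (by norm_num), Real.sqrt_eq_rpow]; rfl
  have hhalf : (0 : ℝ) ≤ 1 / 2 := by norm_num
  have hhalf' : (1 / 2 : ℝ) ≤ 1 := by norm_num
  refine (ENNReal.rpow_le_rpow hsum hhalf).trans ?_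
  rw [ENNReal.mul_rpow_of_nonneg _ _ hhalf, hC2]
  gcongr
  -- Subadditivity of the square root, applied twice, separates the three norms.
  exact (ENNReal.rpow_add_le_add_rpow _ _ hhalf hhalf').trans
    (add_le_add_left (ENNReal.rpow_add_le_add_rpow _ _ hhalf hhalf') _)

end Solution

end ModelSystem

/-! ### The theorem -/

theorem mainTheorem4 (n : ℕ) (hn : 1 ≤ n) (s : ℝ) (hs : 1 ≤ s) (q : ℝ) (hq : 1 ≤ q) (K : ℝ) :
    ∃ C : ℝ≥0, ∀ f₁ f₂ f₃ : ℝ → ℝ,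
      (∀ τ ∈ Set.Ioc (0 : ℝ) 1, |f₁ τ| + |f₂ τ| + |f₃ τ| ≤ K) →
      ∀ (χ₀ O h : ModelSystem.Sph n → ℝ) (α χ : ℝ → ModelSystem.Sph n → ℝ),
        ModelSystem.IsSmoothSolution q f₁ f₂ f₃ χ₀ O h α χ →
        ∀ 𝔥 : ModelSystem.L2 n,
          𝔥 = ModelSystem.toL2 h - ModelSystem.logNabla (ModelSystem.toL2 O) →
          ModelSystem.sobNorm (s + 1 / 2) (ModelSystem.toL2 (α 1))
              + ModelSystem.sobNorm (s - 1 / 2) (ModelSystem.toL2 (ModelSystem.dτ α 1))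
            ≤ C * (ModelSystem.sobNorm s 𝔥 + ModelSystem.sobNorm s (ModelSystem.toL2 O)
              + ModelSystem.sobNorm (s - 1 / 2) (ModelSystem.toL2 χ₀)) ∧
          ModelSystem.sobNorm (s + 1 / 2) (ModelSystem.toL2 (χ 1))
            ≤ C * (ModelSystem.sobNorm s 𝔥 + ModelSystem.sobNorm s (ModelSystem.toL2 O)
              + ModelSystem.sobNorm (s + 1 / 2) (ModelSystem.toL2 χ₀)) := by
  -- `K` may be negative, whereas the mode estimates need a nonnegative bound.
  obtain ⟨C, hC, hest⟩ := ModelSystem.eigenspace_estimate n hq (le_max_right K 0)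
  -- One `√C` for each of the two norms on the left of the first inequality.
  refine ⟨(√C).toNNReal + (√C).toNNReal, ?_⟩
  rintro f₁ f₂ f₃ hf χ₀ O h α χ hS _ rfl
  have hest' := hest f₁ f₂ f₃ (fun τ hτ => by
    have h1 := (hf τ hτ).trans (le_max_left K 0)
    have h2 := abs_nonneg (f₁ τ)
    have h3 := abs_nonneg (f₂ τ)
    have h4 := abs_nonneg (f₃ τ)
    exact ⟨by linarith, by linarith, by linarith⟩) χ₀ O h α χ hS
  have hΛ : ∀ r : ℝ≥0, ∃ Λ : ℝ, 1 ≤ Λ ∧ Λ ^ 2 = 1 + (r : ℝ) ^ 2 ∧ Λ⁻¹ ≤ Λ ∧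
      (1 + (r : ℝ) ^ 2) ^ (s + 1 / 2) = (1 + (r : ℝ) ^ 2) ^ s * Λ ∧
      (1 + (r : ℝ) ^ 2) ^ (s - 1 / 2) = (1 + (r : ℝ) ^ 2) ^ s * Λ⁻¹ := by
    intro r
    have h0 : (0 : ℝ) < 1 + (r : ℝ) ^ 2 := by positivity
    have h1 : 1 ≤ √(1 + (r : ℝ) ^ 2) := Real.one_le_sqrt.2 (by linarith [sq_nonneg (r : ℝ)])
    refine ⟨√(1 + (r : ℝ) ^ 2), h1, Real.sq_sqrt h0.le, (inv_le_one_of_one_le₀ h1).trans h1,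
      ?_, ?_⟩
    · rw [Real.rpow_add h0, Real.sqrt_eq_rpow]
    · rw [sub_eq_add_neg, Real.rpow_add h0, Real.rpow_neg h0.le, Real.sqrt_eq_rpow]
  have hscale : ∀ {w D E : ℝ}, 0 ≤ w → E ≤ D → w * E ≤ w * D := fun hw h =>
    mul_le_mul_of_nonneg_left h hw
  rw [ENNReal.coe_add]
  constructor
  · rw [add_mul]
    refine add_le_add (ModelSystem.sobNorm_le_of_forall hC fun r => ?_)
      (ModelSystem.sobNorm_le_of_forall hC fun r => ?_)
    · obtain ⟨Λ, h1, h2, h3, e1, e2⟩ := hΛ r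
      -- `κ = Λ⁻¹` puts `χ₀` in `H^(s - 1/2)`.
      obtain ⟨D, hD, b1, -, -⟩ := hest' r Λ Λ⁻¹ h1 h2 le_rfl h3
      have hw : 0 ≤ (1 + (r : ℝ) ^ 2) ^ s := by positivity
      rw [e1, e2, mul_assoc]
      exact (hscale hw b1).trans_eq (by rw [hD]; ring)
    · obtain ⟨Λ, h1, h2, h3, e1, e2⟩ := hΛ r
      obtain ⟨D, hD, -, b2, -⟩ := hest' r Λ Λ⁻¹ h1 h2 le_rfl h3
      have hw : 0 ≤ (1 + (r : ℝ) ^ 2) ^ s := by positivity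
      rw [e2, mul_assoc]
      exact (hscale hw b2).trans_eq (by rw [hD]; ring)
  · rw [add_mul]
    refine le_add_right (ModelSystem.sobNorm_le_of_forall hC fun r => ?_)
    obtain ⟨Λ, h1, h2, h3, e1, e2⟩ := hΛ r
    -- `κ = Λ` weights `χ(1)` and `χ₀` by the same `H^(s + 1/2)`.
    obtain ⟨D, hD, -, -, b3⟩ := hest' r Λ Λ h1 h2 h3 le_rfl
    have hw : 0 ≤ (1 + (r : ℝ) ^ 2) ^ s := by positivity
    rw [e1, mul_assoc]
    exact (hscale hw b3).trans_eq (by rw [hD]; ring)
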